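/- Let $p:\mathbb R\to[0,\infty)$ be a probability density with $p(z)=0$ for $z\le 0$, and let $\tilde F(z)=\int_z^\infty p(y)\,dy$. Let $a>0$ (not necessarily an integer), and let $\Omega$ be a measurable function, positive on $(0,1)$, with $\Omega(t)\sim c\,t^{a-1}$ as $t\to0^+$ for some constant $c>0$. Put $$Z_N=\frac1{\Gamma(N)}\int_0^1\Omega(t)(1-t)^{N-1}\,dt ,$$ and assume that $Z_{N_0}<\infty$ for some $N_0\ge1$. Then, for every $N\ge N_0$, $$\Psi_{a,N}(u_1,\dots,u_N)=\frac1{Z_N}\,\Omega\Big[\tilde F\Big(\sum_{n=1}^N u_n\Big)\Big]\prod_{n=1}^N p\Big(\sum_{i=n}^N u_i\Big),\qquad u_1,\dots,u_N>0,$$ is a probability density. Let $(u_1,\dots,u_N)$ have this joint density and let $S_N=\sum_{n=1}^N u_n$. In each of the following three cases there are real constants $\alpha_N$ and $\beta_N>0$ such that $(S_N-\alpha_N)/\beta_N$ converges in distribution, as $N\to\infty$, to the probability law with the indicated density. 1. (Tails decaying faster than any power law.) Suppose that $\tilde F(t)>0$ for all $t$, that $\int_{\omega_0}^\infty\tilde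 F(z)\,dz<\infty$ for some finite $\omega_0$, and that for all $x>0$ $$\lim_{t\to\infty}\frac{\tilde F(t+xR(t))}{\tilde F(t)}=e^{-x},\qquad R(t)=\frac1{\tilde F(t)}\int_t^\infty\tilde F(z)\,dz .$$ The limit is the generalized Gumbel density $$g_a(x)=\frac{a^a\theta_a}{\Gamma(a)}\exp\left[-a\theta_a(x+\nu_a)-a\,e^{-\theta_a(x+\nu_a)}\right],\qquad \theta_a=\sqrt{\psi'(a)},\quad \nu_a=\frac{\ln a-\psi(a)}{\theta_a},\quad \psi=(\ln\Gamma)'.$$ 2. Suppose that $p(z)\sim c'z^{-1-\mu}$ as $z\to\infty$, for some $\mu>0$, $c'>0$. The limit is the generalized Fréchet density $$f_{a,\mu}(x)=\frac{\mu\lambda_f^a}{\Gamma(a)}\,x^{-1-a\mu}\exp\left(-\lambda_f x^{-\mu}\right)\ (x>0),\qquad f_{a,\mu}(x)=0\ (x\le0),$$ where $\lambda_f=\Gamma(a)^\mu\left[\Gamma(a)\Gamma(a-\tfrac2\mu)-\Gamma(a-\tfrac1\mu)^2\right]^{-\mu/2}$ (unit variance) if $a>2/\mu$, and $\lambda_f=1$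 if $a\le2/\mu$ (where the variance is infinite). 3. Suppose that, for some $A\in\mathbb R$ and $\mu>0$, $p(z)=0$ for all $z>A$ and $p(z)\sim c'(A-z)^{\mu-1}$ as $z\to A^-$, for some $c'>0$. The limit is the generalized Weibull density $$w_{a,\mu}(x)=\frac{\mu\lambda_w^a}{\Gamma(a)}(-x)^{\mu a-1}\exp\left(-\lambda_w(-x)^\mu\right)\ (x<0),\qquad w_{a,\mu}(x)=0\ (x\ge0),$$ where $\lambda_w=\Gamma(a)^{-\mu}\left[\Gamma(a)\Gamma(a+\tfrac2\mu)-\Gamma(a+\tfrac1\mu)^2\right]^{\mu/2}$. -/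

import Mathlib

open MeasureTheory Filter Topology Set

noncomputable section

namespace GEV

/-- The tail `F̃(z) = ∫_z^∞ p(y) dy`. -/
def tail (p : ℝ → ℝ) (z : ℝ) : ℝ := ∫ y in Ioi z, p y

/-- `p` is a probability density of a positive random variable. -/
structure IsPosDensity (p : ℝ → ℝ) : Prop where
  measurable : Measurable p
  nonneg : ∀ z, 0 ≤ p z
  eq_zero : ∀ z, z ≤ 0 → p z = 0
  integral_eq_one : ∫ z, p z = 1

/-- `Z_N = (1 / Γ(N)) ∫_0^1 Ω(t) (1 - t)^(N - 1) dt`, meant for `N ≥ 1`. -/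
def normConst (Ω : ℝ → ℝ) (N : ℕ) : ℝ :=
  1 / Real.Gamma N * ∫ t in Ioo (0 : ℝ) 1, Ω t * (1 - t) ^ (N - 1)

/-- The joint density
`Z_N⁻¹ Ω[F̃(u_1 + ⋯ + u_N)] ∏_n p(u_n + u_{n+1} + ⋯ + u_N)`. -/
def jointDensity (p Ω : ℝ → ℝ) (N : ℕ) (u : Fin N → ℝ) : ℝ :=
  (normConst Ω N)⁻¹ * Ω (tail p (∑ n, u n)) * ∏ n, p (∑ i ∈ Finset.Ici n, u i)

/-- The law on `ℝ^N` of the variables `u_1, …, u_N > 0` with this joint density. -/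
def jointLaw (p Ω : ℝ → ℝ) (N : ℕ) : Measure (Fin N → ℝ) :=
  (volume.restrict {u : Fin N → ℝ | ∀ n, 0 < u n}).withDensity
    fun u => ENNReal.ofReal (jointDensity p Ω N u)

/-- The measure on `ℝ` with density `h`. -/
def lawOf (h : ℝ → ℝ) : Measure ℝ := volume.withDensity fun x => ENNReal.ofReal (h x)

/-- Under the laws `P N`, the sum `u_1 + ⋯ + u_N`, after a shift and a dilatation depending on
`N`, converges in distribution to the probability law with density `h`. (The limit has a
continuous distribution function, so distribution functions have to converge everywhere.) -/
def RescaledSumTendsto (P : (N : ℕ) → Measure (Fin N → ℝ)) (h : ℝ → ℝ) : Prop :=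
  IsProbabilityMeasure (lawOf h) ∧
    ∃ α β : ℕ → ℝ, (∀ N, 0 < β N) ∧
      ∀ x : ℝ, Tendsto (fun N => (P N).real {u | ∑ n, u n ≤ α N + β N * x}) atTop
        (𝓝 ((lawOf h).real (Iic x)))

/-- The digamma function `(ln Γ)'`. -/
def digamma (x : ℝ) : ℝ := deriv (fun y => Real.log (Real.Gamma y)) x

/-- `θ_a > 0` with `θ_a² = Ψ'(a)`, where `Ψ` is the digamma function. -/
def gumbelTheta (a : ℝ) : ℝ := Real.sqrt (deriv digamma a)

/-- `ν_a = (ln a - Ψ(a)) / θ_a`. -/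
def gumbelNu (a : ℝ) : ℝ := 1 / gumbelTheta a * (Real.log a - digamma a)

/-- The generalized Gumbel density `g_a` (mean zero, variance one). -/
def gumbelPDF (a x : ℝ) : ℝ :=
  a ^ a * gumbelTheta a / Real.Gamma a *
    Real.exp (-a * gumbelTheta a * (x + gumbelNu a)
      - a * Real.exp (-gumbelTheta a * (x + gumbelNu a)))

open Classical in
/-- The scale `λ_f`: it gives variance one when the variance is finite, i.e. for `a > 2 / μ`.
Otherwise no such normalization exists, and the scale is `1`. -/
def frechetScale (a μ : ℝ) : ℝ :=
  if 2 / μ < a then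
    Real.Gamma a ^ μ *
      (Real.Gamma a * Real.Gamma (a - 2 / μ) - Real.Gamma (a - 1 / μ) ^ 2) ^ (-(μ / 2))
  else 1

open Classical in
/-- The generalized Fréchet density `f_{a,μ}`. -/
def frechetPDF (a μ x : ℝ) : ℝ :=
  if 0 < x then
    μ * frechetScale a μ ^ a / Real.Gamma a * (1 / x ^ (1 + a * μ)) *
      Real.exp (-frechetScale a μ * x ^ (-μ))
  else 0

/-- The scale `λ_w`, which gives variance one. -/
def weibullScale (a μ : ℝ) : ℝ :=
  Real.Gamma a ^ (-μ) *
    (Real.Gamma a * Real.Gamma (a + 2 / μ) - Real.Gamma (a + 1 / μ) ^ 2) ^ (μ / 2)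

open Classical in
/-- The generalized Weibull density `w_{a,μ}`. -/
def weibullPDF (a μ x : ℝ) : ℝ :=
  if x < 0 then
    μ * weibullScale a μ ^ a / Real.Gamma a * (-x) ^ (μ * a - 1) *
      Real.exp (-weibullScale a μ * (-x) ^ μ)
  else 0

/-- `R(t) = F̃(t)⁻¹ ∫_t^∞ F̃(z) dz`. -/
def meanExcess (p : ℝ → ℝ) (t : ℝ) : ℝ := 1 / tail p t * ∫ z in Ioi t, tail p z

/-- The Gumbel tail condition on an unbounded variable: `F̃` is positive everywhere and
integrable at infinity, and `F̃(t + x R(t)) / F̃(t) → e^{-x}` as `t → ∞` for all `x > 0`.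
It is the precise form of a (regular) decay faster than any power law. -/
structure HasGumbelTail (p : ℝ → ℝ) : Prop where
  tail_pos : ∀ t, 0 < tail p t
  integrable : ∃ ω₀ : ℝ, IntegrableOn (tail p) (Ioi ω₀)
  tendsto : ∀ x : ℝ, 0 < x →
    Tendsto (fun t => tail p (t + x * meanExcess p t) / tail p t) atTop (𝓝 (Real.exp (-x)))

/-- `p(z) ∼ c z^{-1-μ}` as `z → ∞`, for some constant `c > 0`. -/
def HasPowerTail (p : ℝ → ℝ) (μ : ℝ) : Prop :=
  ∃ c : ℝ, 0 < c ∧ Tendsto (fun z => p z / z ^ (-1 - μ)) atTop (𝓝 c)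

/-- `p(z) = 0` for `z > A`, and `p(z) ∼ c (A - z)^{μ-1}` as `z → A⁻`, for some constant
`c > 0`. -/
def HasPowerEndpoint (p : ℝ → ℝ) (A μ : ℝ) : Prop :=
  (∀ z, A < z → p z = 0) ∧
    ∃ c : ℝ, 0 < c ∧ Tendsto (fun z => p z / (A - z) ^ (μ - 1)) (𝓝[<] A) (𝓝 c)

end GEV

end

namespace GEV

/-! The partial sums `z_n = u_n + ⋯ + u_N` form a decreasing sequence with maximum `z_1 = S_N`, and
the map from `u` to `z` has unit Jacobian. The product of the `p(z_n)` is thus the density of an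
ordered i.i.d. sample, up to the factor `N!`, and `Ω` reweights it through its maximum alone.
Integrating out the smaller `z_n` leaves `(1 - F̃(z))^(N-1) / (N-1)!`. Since `F̃` of a variable of
density `p` is uniform on `(0,1)`, this gives `P(S_N ≤ y) = ∫_{F̃(y)}^1 Ω(t)(1-t)^(N-1) dt / ∫_0^1
Ω(t)(1-t)^(N-1) dt` (`sumIntegral_succ_eq`, `jointLaw_sum_le`).

After the substitution `t = y/N`, only the behaviour `Ω(t) ∼ c t^(a-1)` at the origin survives: `N
F̃(S_N)` converges in law to a Gamma variable of shape `a` (`tendsto_upperIntegral_ratio`). If `N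
F̃(α_N + β_N x) → τ(x)`, the limit distribution function is therefore `P(Gamma_a > τ(x))`
(`rescaledSumTendsto`).

What remains is classical extreme value theory, with `τ(x)` equal to `a e^{-θ(x+ν)}`, `λ x^{-μ}` or
`λ (-x)^μ`. The three limit densities are the pullbacks of the Gamma density under these maps. The
power cases follow from Karamata-type integration of `p`. In the Gumbel case the hypothesis concerns
`x > 0` only, and it extends to all real `x` because the mean excess is self-neglecting. -/

variable {p Ω : ℝ → ℝ}

/-! ### Log-convexity of Γ and positivity of the normalizing scales. -/

theorem analyticAt_Gamma {x : ℝ} (hx : 0 < x) : AnalyticAt ℝ Real.Gamma x := by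
  have hopen : IsOpen {s : ℂ | 0 < s.re} := isOpen_lt continuous_const Complex.continuous_re
  -- Complex differentiability on the open half-plane already gives analyticity; the real function
  -- inherits it, so `log Γ` can be differentiated twice.
  have hd : DifferentiableOn ℂ Complex.Gamma {s : ℂ | 0 < s.re} := fun s hs =>
    (Complex.differentiableAt_Gamma s fun m h => by
      have := congrArg Complex.re h
      simp only [Complex.neg_re, Complex.natCast_re] at this
      have hs' : 0 < s.re := hs
      have := Nat.cast_nonneg (α := ℝ) m
      linarith).differentiableWithinAt
  have h := hd.analyticAt (hopen.mem_nhds (show (x : ℂ) ∈ {s : ℂ | 0 < s.re} by simpa using hx))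
  have := h.re_ofReal
  refine this.congr (Eventually.of_forall fun y => ?_)
  simp [Complex.Gamma_ofReal]

theorem analyticAt_log_Gamma {x : ℝ} (hx : 0 < x) :
    AnalyticAt ℝ (fun y => Real.log (Real.Gamma y)) x :=
  (analyticAt_Gamma hx).log (Real.Gamma_pos_of_pos hx)

theorem differentiableAt_digamma {x : ℝ} (hx : 0 < x) : DifferentiableAt ℝ digamma x :=
  (analyticAt_log_Gamma hx).deriv.differentiableAt

theorem digamma_add_one {x : ℝ} (hx : 0 < x) : digamma (x + 1) = digamma x + x⁻¹ := by
  unfold digamma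
  rw [← deriv_comp_add_const]
  have : (fun y => Real.log (Real.Gamma (y + 1))) =ᶠ[𝓝 x]
      fun y => Real.log (Real.Gamma y) + Real.log y := by
    filter_upwards [lt_mem_nhds hx] with y hy
    rw [Real.Gamma_add_one hy.ne', Real.log_mul hy.ne' (Real.Gamma_pos_of_pos hy).ne', add_comm]
  rw [this.deriv_eq]
  exact ((analyticAt_log_Gamma hx).differentiableAt.hasDerivAt.add
    (Real.hasDerivAt_log hx.ne')).deriv

theorem monotoneOn_digamma : MonotoneOn digamma (Ioi 0) :=
  Real.convexOn_log_Gamma.monotoneOn_deriv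
    fun _ hx => (analyticAt_log_Gamma hx).differentiableAt

theorem deriv_digamma_nonneg {x : ℝ} (hx : 0 < x) : 0 ≤ deriv digamma x := by
  rw [← derivWithin_of_isOpen isOpen_Ioi hx]
  exact monotoneOn_digamma.derivWithin_nonneg

/-- Convexity of `log Γ` gives only `ψ' ≥ 0`; the recurrence `ψ'(x) = ψ'(x+1) + x⁻²` makes the
inequality strict. -/
theorem deriv_digamma_pos {x : ℝ} (hx : 0 < x) : 0 < deriv digamma x := by
  have h1 : deriv digamma (x + 1) = deriv digamma x + -(x ^ 2)⁻¹ := by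
    rw [← deriv_comp_add_const]
    have : (fun y => digamma (y + 1)) =ᶠ[𝓝 x] fun y => digamma y + y⁻¹ := by
      filter_upwards [lt_mem_nhds hx] with y hy using digamma_add_one hy
    rw [this.deriv_eq]
    exact ((differentiableAt_digamma hx).hasDerivAt.add (hasDerivAt_inv hx.ne')).deriv
  have h2 := deriv_digamma_nonneg (x := x + 1) (by positivity)
  have : 0 < (x ^ 2)⁻¹ := by positivity
  linarith

theorem gumbelTheta_pos {a : ℝ} (ha : 0 < a) : 0 < gumbelTheta a :=
  Real.sqrt_pos.2 (deriv_digamma_pos ha)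

theorem strictConvexOn_log_Gamma :
    StrictConvexOn ℝ (Ioi 0) fun y => Real.log (Real.Gamma y) := by
  refine strictConvexOn_of_deriv2_pos (convex_Ioi 0)
    (fun x hx => (analyticAt_log_Gamma hx).continuousAt.continuousWithinAt) fun x hx => ?_
  rw [interior_Ioi] at hx
  exact deriv_digamma_pos hx

/-- Strict midpoint convexity of `log Γ`. It makes the variance-like differences inside
`frechetScale` and `weibullScale` positive. -/
theorem Gamma_sq_lt_Gamma_mul_Gamma {x y m : ℝ} (hx : 0 < x) (hxy : x < y)
    (hm : 2 * m = x + y) : Real.Gamma m ^ 2 < Real.Gamma x * Real.Gamma y := by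
  have hy : 0 < y := hx.trans hxy
  have h := strictConvexOn_log_Gamma.2 (mem_Ioi.2 hx) (mem_Ioi.2 hy) hxy.ne
    (show (0 : ℝ) < 1 / 2 by norm_num) (show (0 : ℝ) < 1 / 2 by norm_num) (by norm_num)
  simp only [smul_eq_mul] at h
  rw [show 1 / 2 * x + 1 / 2 * y = m by linarith] at h
  have hm0 : 0 < m := by linarith
  have gx := Real.Gamma_pos_of_pos hx
  have gy := Real.Gamma_pos_of_pos hy
  have gm := Real.Gamma_pos_of_pos hm0
  rw [← Real.log_lt_log_iff (by positivity) (by positivity), Real.log_pow,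
    Real.log_mul gx.ne' gy.ne']
  push_cast
  linarith

theorem frechetScale_pos {a μ : ℝ} (ha : 0 < a) (hμ : 0 < μ) : 0 < frechetScale a μ := by
  unfold frechetScale
  split_ifs with h
  · have hd : 0 < 2 / μ := by positivity
    have := Gamma_sq_lt_Gamma_mul_Gamma (x := a - 2 / μ) (y := a) (m := a - 1 / μ)
      (by linarith) (by linarith) (by ring)
    exact mul_pos (Real.rpow_pos_of_pos (Real.Gamma_pos_of_pos ha) _)
      (Real.rpow_pos_of_pos (by linarith) _)
  · exact one_pos

theorem weibullScale_pos {a μ : ℝ} (ha : 0 < a) (hμ : 0 < μ) : 0 < weibullScale a μ := by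
  have hd : 0 < 2 / μ := by positivity
  have := Gamma_sq_lt_Gamma_mul_Gamma (x := a) (y := a + 2 / μ) (m := a + 1 / μ)
    ha (by linarith) (by ring)
  exact mul_pos (Real.rpow_pos_of_pos (Real.Gamma_pos_of_pos ha) _)
    (Real.rpow_pos_of_pos (by linarith) _)

/-! ### The tail function and the uniform law of `F̃`. -/

theorem IsPosDensity.integrable (hp : IsPosDensity p) : Integrable p := by
  by_contra h
  have := hp.integral_eq_one
  rw [integral_undef h] at this
  norm_num at this

theorem IsPosDensity.isProbabilityMeasure (hp : IsPosDensity p) :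
    IsProbabilityMeasure (lawOf p) := by
  refine ⟨?_⟩
  rw [lawOf, withDensity_apply _ MeasurableSet.univ, Measure.restrict_univ,
    ← ofReal_integral_eq_lintegral_ofReal hp.integrable (Eventually.of_forall hp.nonneg),
    hp.integral_eq_one, ENNReal.ofReal_one]

theorem IsPosDensity.lawOf_Ioi (hp : IsPosDensity p) (z : ℝ) :
    lawOf p (Ioi z) = ENNReal.ofReal (tail p z) := by
  rw [lawOf, withDensity_apply _ measurableSet_Ioi, tail,
    ofReal_integral_eq_lintegral_ofReal hp.integrable.integrableOn
      (Eventually.of_forall hp.nonneg)]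

theorem IsPosDensity.tail_nonneg (hp : IsPosDensity p) (z : ℝ) : 0 ≤ tail p z :=
  setIntegral_nonneg measurableSet_Ioi fun y _ => hp.nonneg y

theorem IsPosDensity.tail_antitone (hp : IsPosDensity p) : Antitone (tail p) := fun _ _ h =>
  setIntegral_mono_set hp.integrable.integrableOn (Eventually.of_forall hp.nonneg)
    (Ioi_subset_Ioi h).eventuallyLE

theorem IsPosDensity.tail_of_nonpos (hp : IsPosDensity p) {z : ℝ} (hz : z ≤ 0) :
    tail p z = 1 := by
  rw [tail, ← hp.integral_eq_one]
  refine setIntegral_eq_integral_of_forall_compl_eq_zero fun x hx => hp.eq_zero x ?_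
  simp only [mem_Ioi, not_lt] at hx
  linarith

theorem IsPosDensity.tail_le_one (hp : IsPosDensity p) (z : ℝ) : tail p z ≤ 1 := by
  rcases le_total z 0 with h | h
  · exact (hp.tail_of_nonpos h).le
  · exact (hp.tail_antitone h).trans (hp.tail_of_nonpos le_rfl).le

theorem IsPosDensity.continuous_tail (hp : IsPosDensity p) : Continuous (tail p) := by
  have h : tail p = fun z => 1 - ∫ y in (0 : ℝ)..z, p y := by
    ext z
    have h0 : ∫ y in Ioi (0 : ℝ), p y = 1 := hp.tail_of_nonpos le_rfl
    rw [← h0, ← intervalIntegral.integral_Ioi_sub_Ioi' hp.integrable.integrableOn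
      hp.integrable.integrableOn]
    simp [tail]
  rw [h]
  exact continuous_const.sub (intervalIntegral.continuous_primitive
    (fun _ _ => hp.integrable.intervalIntegrable) 0)

theorem IsPosDensity.tendsto_tail_atTop (hp : IsPosDensity p) :
    Tendsto (tail p) atTop (𝓝 0) := by
  have := hp.isProbabilityMeasure
  have h : Tendsto (fun z : ℝ => lawOf p (Ioi z)) atTop (𝓝 0) := by
    have := tendsto_measure_iInter_atTop (μ := lawOf p) (s := fun z : ℝ => Ioi z)
      (fun _ => measurableSet_Ioi.nullMeasurableSet) (fun _ _ h => Ioi_subset_Ioi h)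
      ⟨0, measure_ne_top _ _⟩
    have hi : ⋂ z : ℝ, Ioi z = ∅ := eq_empty_of_forall_notMem fun x hx =>
      lt_irrefl x (mem_iInter.1 hx x)
    rwa [hi, measure_empty] at this
  simp_rw [hp.lawOf_Ioi] at h
  have := (ENNReal.tendsto_toReal ENNReal.zero_ne_top).comp h
  simpa [Function.comp_def, ENNReal.toReal_ofReal (hp.tail_nonneg _)] using this

theorem IsPosDensity.lawOf_Iic (hp : IsPosDensity p) (z : ℝ) :
    lawOf p (Iic z) = ENNReal.ofReal (1 - tail p z) := by
  have := hp.isProbabilityMeasure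
  rw [← compl_Ioi, prob_compl_eq_one_sub measurableSet_Ioi, hp.lawOf_Ioi,
    ENNReal.ofReal_sub _ (hp.tail_nonneg z), ENNReal.ofReal_one]

/-- A probability integral transform: the tail of a random variable of density `p` is uniform. -/
theorem IsPosDensity.map_tail (hp : IsPosDensity p) :
    (lawOf p).map (tail p) = volume.restrict (Ioo 0 1) := by
  have hP := hp.isProbabilityMeasure
  have hm : Measurable (tail p) := hp.continuous_tail.measurable
  have := Measure.isProbabilityMeasure_map (μ := lawOf p) hm.aemeasurable
  refine Measure.ext_of_Ici _ _ fun t => ?_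
  rw [Measure.map_apply hm measurableSet_Ici, Measure.restrict_apply measurableSet_Ici]
  rcases le_or_gt t 0 with h0 | h0
  · have h1 : tail p ⁻¹' Ici t = univ := by
      ext z; simpa using h0.trans (hp.tail_nonneg z)
    have h2 : Ici t ∩ Ioo 0 1 = Ioo 0 1 := by
      ext z; simp only [mem_inter_iff, mem_Ici, mem_Ioo]; grind
    simp [h1, h2]
  rcases lt_or_ge 1 t with ht | ht
  · have h1 : tail p ⁻¹' Ici t = ∅ := by
      ext z; simpa using (hp.tail_le_one z).trans_lt ht
    have h2 : Ici t ∩ Ioo 0 1 = ∅ := by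
      ext z; simp only [mem_inter_iff, mem_Ici, mem_Ioo, mem_empty_iff_false]; grind
    simp [h1, h2]
  have hc : IsClosed (tail p ⁻¹' Ici t) := isClosed_Ici.preimage hp.continuous_tail
  have hne : (tail p ⁻¹' Ici t).Nonempty := ⟨0, by simpa [hp.tail_of_nonpos le_rfl] using ht⟩
  have hb : BddAbove (tail p ⁻¹' Ici t) := by
    obtain ⟨B, hB⟩ := (hp.tendsto_tail_atTop.eventually_lt_const h0).exists
    refine ⟨B, fun z hz => ?_⟩
    by_contra h
    have := hp.tail_antitone (not_le.1 h).le
    have : t ≤ tail p z := hz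
    linarith
  -- `F̃` may be flat at height `t`, so the last point of the closed superlevel set is used. Beyond
  -- it `F̃ < t`, and continuity forces `F̃(b) = t`.
  set b := sSup (tail p ⁻¹' Ici t) with hbdef
  have hbm : t ≤ tail p b := hc.csSup_mem hne hb
  have hset : tail p ⁻¹' Ici t = Iic b := by
    ext z
    exact ⟨fun h => le_csSup hb h, fun h => hbm.trans (hp.tail_antitone h)⟩
  have hbt : tail p b = t := by
    refine le_antisymm ?_ hbm
    refine le_of_tendsto (hp.continuous_tail.continuousAt.tendsto.mono_left
      (nhdsWithin_le_nhds (s := Ioi b))) ?_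
    filter_upwards [self_mem_nhdsWithin] with z hz
    by_contra h
    have h3 : z ∈ Iic b := hset.subset (not_le.1 h).le
    exact (not_lt.2 (mem_Iic.1 h3)) (mem_Ioi.1 hz)
  have h2 : Ici t ∩ Ioo 0 1 = Ico t 1 := by
    ext z; simp only [mem_inter_iff, mem_Ici, mem_Ioo, mem_Ico]; grind
  rw [hset, hp.lawOf_Iic, hbt, h2, Real.volume_Ico]

theorem IsPosDensity.lintegral_comp_tail (hp : IsPosDensity p) {g : ℝ → ENNReal}
    (hg : Measurable g) :
    ∫⁻ z, g (tail p z) ∂(lawOf p) = ∫⁻ t in Ioo 0 1, g t := by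
  rw [← hp.map_tail, lintegral_map hg hp.continuous_tail.measurable]

/-- If `F̃` is constant to the right of `y`, the superlevel set is strictly larger than `Iic y`, but
both have mass `1 - F̃(y)`. -/
theorem IsPosDensity.Iic_ae_eq (hp : IsPosDensity p) (y : ℝ) :
    (Iic y : Set ℝ) =ᵐ[lawOf p] tail p ⁻¹' Ici (tail p y) := by
  have hP := hp.isProbabilityMeasure
  have hm : Measurable (tail p) := hp.continuous_tail.measurable
  refine ae_eq_of_subset_of_measure_ge (fun z hz => hp.tail_antitone hz) ?_
    measurableSet_Iic.nullMeasurableSet (measure_ne_top _ _)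
  rw [← Measure.map_apply hm measurableSet_Ici, hp.map_tail,
    Measure.restrict_apply measurableSet_Ici, hp.lawOf_Iic, ← Real.volume_Icc]
  exact measure_mono fun z hz => ⟨hz.1, hz.2.2.le⟩

/-! ### Integrating out the smaller partial sums. -/

/-- The integral of `g (u_1 + ⋯ + u_N)` against the weight `∏_n p(u_n + ⋯ + u_N)` over the positive
orthant. -/
noncomputable def sumIntegral (p : ℝ → ℝ) (N : ℕ) (g : ℝ → ENNReal) : ENNReal :=
  ∫⁻ u in {u : Fin N → ℝ | ∀ n, 0 < u n},
    g (∑ n, u n) * ∏ n, ENNReal.ofReal (p (∑ i ∈ Finset.Ici n, u i))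

theorem measurableSet_orthant (N : ℕ) : MeasurableSet {u : Fin N → ℝ | ∀ n, 0 < u n} := by
  simp only [ofPred_forall]
  exact MeasurableSet.iInter fun n => measurableSet_lt measurable_const (measurable_pi_apply n)

theorem measurable_weight (hpm : Measurable p) (N : ℕ) :
    Measurable fun u : Fin N → ℝ => ∏ n, ENNReal.ofReal (p (∑ i ∈ Finset.Ici n, u i)) := by
  refine Finset.measurable_prod _ fun n _ => ENNReal.measurable_ofReal.comp (hpm.comp ?_)
  fun_prop

theorem measurable_lintegral_Ioi (μ : Measure ℝ) (g : ℝ → ENNReal) :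
    Measurable fun s : ℝ => ∫⁻ z in Ioi s, g z ∂μ :=
  Antitone.measurable fun _ _ h => lintegral_mono_set (Ioi_subset_Ioi h)

theorem sumIntegral_zero (g : ℝ → ENNReal) : sumIntegral p 0 g = g 0 := by
  simp [sumIntegral, volume_pi]

/-- The coordinate of index `0` enters only the total sum, hence only `g` and the first factor `p`.
With `s` the sum of the other coordinates, the substitution `z = x + s` turns the integral over `x >
0` into one over `z > s` against the law of density `p`. -/
theorem sumIntegral_succ (hpm : Measurable p) (N : ℕ) {g : ℝ → ENNReal} (hg : Measurable g) :
    sumIntegral p (N + 1) g = sumIntegral p N fun s => ∫⁻ z in Ioi s, g z ∂(lawOf p) := by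
  have hP : Measurable fun z => ENNReal.ofReal (p z) := ENNReal.measurable_ofReal.comp hpm
  have hG (s : ℝ) : ∫⁻ z in Ioi s, g z ∂(lawOf p)
      = ∫⁻ x, (Ioi (0 : ℝ)).indicator (fun x => g (x + s) * ENNReal.ofReal (p (x + s))) x := by
    rw [lawOf, restrict_withDensity measurableSet_Ioi,
      lintegral_withDensity_eq_lintegral_mul _ hP hg,
      ← lintegral_indicator measurableSet_Ioi, ← lintegral_add_right_eq_self _ s]
    congr 1 with x
    by_cases h : 0 < x
    · simp [h, mul_comm]
    · simp [h]
  set e := MeasurableEquiv.piFinSuccAbove (fun _ : Fin (N + 1) => ℝ) 0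
  have he : MeasurePreserving e.symm := (volume_preserving_piFinSuccAbove (fun _ => ℝ) 0).symm e
  have hF : Measurable ({u : Fin (N + 1) → ℝ | ∀ n, 0 < u n}.indicator fun u =>
      g (∑ n, u n) * ∏ n, ENNReal.ofReal (p (∑ i ∈ Finset.Ici n, u i))) :=
    ((hg.comp (by fun_prop)).mul (measurable_weight hpm _)).indicator (measurableSet_orthant _)
  rw [sumIntegral, ← lintegral_indicator (measurableSet_orthant _), ← he.lintegral_comp hF,
    Measure.volume_eq_prod, lintegral_prod_symm _
      (by exact (hF.comp e.symm.measurable).aemeasurable),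
    sumIntegral, ← lintegral_indicator (measurableSet_orthant _)]
  refine lintegral_congr fun v => ?_
  -- The integrand splits into a factor free of `x` and a factor that sees the other coordinates
  -- only through their sum.
  have hpt (x : ℝ) : ({u : Fin (N + 1) → ℝ | ∀ n, 0 < u n}.indicator (fun u =>
      g (∑ n, u n) * ∏ n, ENNReal.ofReal (p (∑ i ∈ Finset.Ici n, u i))) (e.symm (x, v)))
      = {u : Fin N → ℝ | ∀ n, 0 < u n}.indicator
          (fun v => ∏ n, ENNReal.ofReal (p (∑ i ∈ Finset.Ici n, v i))) v *
        (Ioi (0 : ℝ)).indicator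
          (fun x => g (x + ∑ n, v n) * ENNReal.ofReal (p (x + ∑ n, v n))) x := by
    have h0 : e.symm (x, v) = Fin.cons x v := by
      simp [e, MeasurableEquiv.piFinSuccAbove, Fin.consEquiv]
    rw [h0]
    by_cases hx : 0 < x
    · by_cases hv : ∀ n, 0 < v n
      · have : ∀ n, 0 < (Fin.cons x v : Fin (N + 1) → ℝ) n := Fin.cases hx hv
        have hs (n : Fin N) : ∑ i ∈ Finset.Ici n.succ, (Fin.cons x v : Fin (N + 1) → ℝ) i
            = ∑ i ∈ Finset.Ici n, v i := by
          rw [← Fin.map_succEmb_Ici, Finset.sum_map]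
          simp
        have h1 : (Finset.Ici (0 : Fin (N + 1))) = Finset.univ := by
          ext i; simp
        rw [indicator_of_mem (show _ ∈ {u : Fin (N + 1) → ℝ | ∀ n, 0 < u n} from this),
          indicator_of_mem (show v ∈ {u : Fin N → ℝ | ∀ n, 0 < u n} from hv),
          indicator_of_mem (mem_Ioi.2 hx), Fin.prod_univ_succ]
        simp only [hs, h1, Fin.sum_univ_succ, Fin.cons_zero, Fin.cons_succ]
        ring
      · have : ¬ ∀ n, 0 < (Fin.cons x v : Fin (N + 1) → ℝ) n := fun h => hv fun n => by
          simpa using h n.succ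
        simp only [indicator, mem_ofPred_eq, if_neg this, if_neg hv, zero_mul]
    · have : ¬ ∀ n, 0 < (Fin.cons x v : Fin (N + 1) → ℝ) n := fun h => hx (by simpa using h 0)
      simp only [indicator, mem_ofPred_eq, if_neg this, mem_Ioi, if_neg hx, mul_zero]
  simp only [hpt]
  rw [lintegral_const_mul, ← hG]
  · by_cases hv : ∀ n, 0 < v n
    · simp only [indicator, mem_ofPred_eq, if_pos hv, mul_comm]
    · simp only [indicator, mem_ofPred_eq, if_neg hv, zero_mul]
  · exact ((hg.comp (measurable_id.add_const _)).mul
      (hP.comp (measurable_id.add_const _))).indicator measurableSet_Ioi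

theorem lintegral_one_sub_pow {s : ℝ} (hs0 : 0 ≤ s) (hs1 : s ≤ 1) (N : ℕ) :
    ∫⁻ t in Ioo (0 : ℝ) 1, (Ici s).indicator
      (fun t => ENNReal.ofReal ((1 - t) ^ N / N.factorial)) t
      = ENNReal.ofReal ((1 - s) ^ (N + 1) / (N + 1).factorial) := by
  have hset : (Ici s ∩ Ioo (0 : ℝ) 1 : Set ℝ) =ᵐ[volume] Ioc s 1 := by
    have h1 : ({0, 1, s}ᶜ : Set ℝ) ∈ ae volume :=
      compl_mem_ae_iff.2 ((toFinite ({0, 1, s} : Set ℝ)).measure_zero _)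
    filter_upwards [h1] with t ht
    simp only [mem_compl_iff, mem_insert_iff, mem_singleton_iff, not_or] at ht
    apply propext
    change (s ≤ t ∧ 0 < t ∧ t < 1) ↔ (s < t ∧ t ≤ 1)
    grind
  rw [lintegral_indicator measurableSet_Ici, Measure.restrict_restrict measurableSet_Ici,
    Measure.restrict_congr_set hset, ← ofReal_integral_eq_lintegral_ofReal,
    ← intervalIntegral.integral_of_le hs1]
  · congr 1
    rw [intervalIntegral.integral_div, intervalIntegral.integral_comp_sub_left (fun t => t ^ N),
      integral_pow, Nat.factorial_succ]
    push_cast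
    have : (N.factorial : ℝ) ≠ 0 := by positivity
    field_simp
    simp
  · exact (Continuous.integrableOn_Icc (by fun_prop)).mono_set Ioc_subset_Icc_self
  · filter_upwards [ae_restrict_mem measurableSet_Ioc] with t ht
    have : 0 ≤ 1 - t := by linarith [ht.2]
    positivity

/-- `(1 - F̃(z))^N / N!` is the probability that `N` independent variables lie below `z` in a
prescribed order. The function `g` must vary in the induction, since `sumIntegral_succ` replaces it
by its integral over a half-line. -/
theorem IsPosDensity.sumIntegral_succ_eq (hp : IsPosDensity p) (N : ℕ) :
    ∀ {g : ℝ → ENNReal}, Measurable g → sumIntegral p (N + 1) g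
      = ∫⁻ z, g z * ENNReal.ofReal ((1 - tail p z) ^ N / N.factorial) ∂(lawOf p) := by
  have hP := hp.isProbabilityMeasure
  have htm : Measurable (tail p) := hp.continuous_tail.measurable
  induction N with
  | zero =>
    intro g hg
    rw [sumIntegral_succ hp.measurable _ hg, sumIntegral_zero]
    -- All the mass of `p` is on the positive half-line, so the constraint `u > 0` costs nothing.
    have h0 : (Ioi (0 : ℝ) : Set ℝ) =ᵐ[lawOf p] univ := by
      rw [ae_eq_univ, compl_Ioi, hp.lawOf_Iic, hp.tail_of_nonpos le_rfl]
      simp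
    rw [Measure.restrict_congr_set h0]
    simp
  | succ N ih =>
    intro g hg
    rw [sumIntegral_succ hp.measurable _ hg, ih (measurable_lintegral_Ioi _ _)]
    set k : ℝ → ENNReal := fun t => ENNReal.ofReal ((1 - t) ^ N / N.factorial) with hk
    have hkm : Measurable k := by fun_prop
    have hna : NullSingletonClass (lawOf p) := by
      unfold lawOf; infer_instance
    have hinner (z : ℝ) : ∫⁻ w in Iio z, k (tail p w) ∂(lawOf p)
        = ENNReal.ofReal ((1 - tail p z) ^ (N + 1) / (N + 1).factorial) := by
      rw [← lintegral_one_sub_pow (hp.tail_nonneg z) (hp.tail_le_one z),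
        ← hp.lintegral_comp_tail (hkm.indicator measurableSet_Ici),
        Measure.restrict_congr_set (Iio_ae_eq_Iic.trans (hp.Iic_ae_eq z)),
        ← lintegral_indicator (htm measurableSet_Ici)]
      rfl
    -- Tonelli on `{w < z}`: integrating over the smaller variable `w` first raises the exponent by
    -- one.
    calc ∫⁻ w, (∫⁻ z in Ioi w, g z ∂(lawOf p)) * k (tail p w) ∂(lawOf p)
        = ∫⁻ w, ∫⁻ z, {q : ℝ × ℝ | q.1 < q.2}.indicator
            (fun q => g q.2 * k (tail p q.1)) (w, z) ∂(lawOf p) ∂(lawOf p) := by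
          refine lintegral_congr fun w => ?_
          rw [← lintegral_mul_const _ hg, ← lintegral_indicator measurableSet_Ioi]
          rfl
      _ = ∫⁻ z, ∫⁻ w, {q : ℝ × ℝ | q.1 < q.2}.indicator
            (fun q => g q.2 * k (tail p q.1)) (w, z) ∂(lawOf p) ∂(lawOf p) := by
          refine lintegral_lintegral_swap (Measurable.aemeasurable ?_)
          exact ((hg.comp measurable_snd).mul (hkm.comp (htm.comp measurable_fst))).indicator
            (measurableSet_lt measurable_fst measurable_snd)
      _ = _ := by
          refine lintegral_congr fun z => ?_
          rw [← hinner, ← lintegral_const_mul _ (by exact hkm.comp htm),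
            ← lintegral_indicator measurableSet_Iio]
          rfl

theorem IsPosDensity.jointLaw_succ_apply (hp : IsPosDensity p) (hΩm : Measurable Ω) (N : ℕ)
    {B : Set ℝ} (hB : MeasurableSet B) :
    jointLaw p Ω (N + 1) {u | ∑ n, u n ∈ B} =
      ∫⁻ z in B, ENNReal.ofReal ((normConst Ω (N + 1))⁻¹ * Ω (tail p z)) *
        ENNReal.ofReal ((1 - tail p z) ^ N / N.factorial) ∂(lawOf p) := by
  have htm : Measurable (tail p) := hp.continuous_tail.measurable
  have hS : MeasurableSet {u : Fin (N + 1) → ℝ | ∑ n, u n ∈ B} :=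
    hB.preimage (f := fun u : Fin (N + 1) → ℝ => ∑ n, u n) (by fun_prop)
  have hg : Measurable fun z => ENNReal.ofReal ((normConst Ω (N + 1))⁻¹ * Ω (tail p z)) :=
    ENNReal.measurable_ofReal.comp (measurable_const.mul (hΩm.comp htm))
  have := hp.sumIntegral_succ_eq N (hg.indicator hB)
  rw [sumIntegral] at this
  rw [jointLaw, withDensity_apply _ hS, ← lintegral_indicator hS, ← lintegral_indicator hB]
  convert this using 1
  · refine lintegral_congr fun u => ?_
    by_cases h : ∑ n, u n ∈ B
    -- Only the product of the `p` needs to be nonnegative to split `ofReal`; the sign of `Ω` at the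
    -- values `0` and `1` of `F̃`, outside its domain of positivity, is irrelevant.
    · rw [indicator_of_mem (show u ∈ {u : Fin (N + 1) → ℝ | ∑ n, u n ∈ B} from h),
        indicator_of_mem h, jointDensity,
        ENNReal.ofReal_mul' (Finset.prod_nonneg fun n _ => hp.nonneg _),
        ENNReal.ofReal_prod_of_nonneg fun n _ => hp.nonneg _]
    · rw [indicator_of_notMem (show u ∉ {u : Fin (N + 1) → ℝ | ∑ n, u n ∈ B} from h),
        indicator_of_notMem h, zero_mul]
  · refine lintegral_congr fun z => ?_
    by_cases h : z ∈ B <;> simp [h]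

/-! ### The distribution function of the sum as a ratio of integrals. -/

/-- `∫_s^1 Ω(t) (1 - t)^(N - 1) dt`. -/
noncomputable def upperIntegral (Ω : ℝ → ℝ) (N : ℕ) (s : ℝ) : ℝ :=
  ∫ t in Ioo s 1, Ω t * (1 - t) ^ (N - 1)

theorem integrableOn_weight (hΩm : Measurable Ω) {N₀ N : ℕ} (hN : N₀ ≤ N)
    (hZ : IntegrableOn (fun t => Ω t * (1 - t) ^ (N₀ - 1)) (Ioo (0 : ℝ) 1)) :
    IntegrableOn (fun t => Ω t * (1 - t) ^ (N - 1)) (Ioo (0 : ℝ) 1) := by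
  refine Integrable.mono hZ (by fun_prop) ?_
  filter_upwards [ae_restrict_mem measurableSet_Ioo] with t ht
  have h0 : 0 ≤ 1 - t := by linarith [ht.2]
  rw [norm_mul, norm_mul, norm_pow, norm_pow, Real.norm_of_nonneg h0]
  exact mul_le_mul_of_nonneg_left
    (pow_le_pow_of_le_one h0 (by linarith [ht.1]) (by omega)) (norm_nonneg _)

theorem weight_pos (hΩpos : ∀ t ∈ Ioo (0 : ℝ) 1, 0 < Ω t) (N : ℕ) {t : ℝ}
    (ht : t ∈ Ioo (0 : ℝ) 1) : 0 < Ω t * (1 - t) ^ (N - 1) :=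
  mul_pos (hΩpos t ht) (pow_pos (by linarith [ht.2]) _)

theorem upperIntegral_zero_pos (hΩpos : ∀ t ∈ Ioo (0 : ℝ) 1, 0 < Ω t) {N : ℕ}
    (hZ : IntegrableOn (fun t => Ω t * (1 - t) ^ (N - 1)) (Ioo (0 : ℝ) 1)) :
    0 < upperIntegral Ω N 0 := by
  rw [upperIntegral, setIntegral_pos_iff_support_of_nonneg_ae _ hZ]
  · have h : Ioo (0 : ℝ) 1 ⊆ Function.support fun t => Ω t * (1 - t) ^ (N - 1) :=
      fun t ht => (weight_pos hΩpos N ht).ne'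
    rw [inter_eq_self_of_subset_right h]
    simp
  · filter_upwards [ae_restrict_mem measurableSet_Ioo] with t ht using (weight_pos hΩpos N ht).le

/-- A general `B` serves both `Iic y`, for the distribution function, and `univ` with `s = 0`, for
the total mass. -/
theorem IsPosDensity.jointLaw_sum_mem (hp : IsPosDensity p) (hΩm : Measurable Ω)
    (hΩpos : ∀ t ∈ Ioo (0 : ℝ) 1, 0 < Ω t) {N : ℕ} (hN : 1 ≤ N)
    (hZ : IntegrableOn (fun t => Ω t * (1 - t) ^ (N - 1)) (Ioo (0 : ℝ) 1))
    {B : Set ℝ} (hB : MeasurableSet B) {s : ℝ} (hs : 0 ≤ s)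
    (hBs : B =ᵐ[lawOf p] tail p ⁻¹' Ici s) :
    jointLaw p Ω N {u | ∑ n, u n ∈ B} =
      ENNReal.ofReal (upperIntegral Ω N s / upperIntegral Ω N 0) := by
  obtain ⟨M, rfl⟩ : ∃ M, N = M + 1 := ⟨N - 1, by omega⟩
  have htm : Measurable (tail p) := hp.continuous_tail.measurable
  have hK := upperIntegral_zero_pos hΩpos hZ
  simp only [add_tsub_cancel_right] at hZ
  have hM : (0 : ℝ) < M.factorial := by positivity
  -- The factor `1/Γ(M+1) = 1/M!` will cancel the `1/M!` produced by the ordering.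
  have hZ' : normConst Ω (M + 1) = upperIntegral Ω (M + 1) 0 / M.factorial := by
    rw [normConst, upperIntegral]
    push_cast
    rw [Real.Gamma_nat_eq_factorial]
    ring
  set k : ℝ → ENNReal := fun t => ENNReal.ofReal ((normConst Ω (M + 1))⁻¹ * Ω t) *
    ENNReal.ofReal ((1 - t) ^ M / M.factorial) with hk
  have hkm : Measurable k := by fun_prop
  have hset : (Ici s ∩ Ioo (0 : ℝ) 1 : Set ℝ) =ᵐ[volume] Ioo s 1 := by
    have h1 : ({s}ᶜ : Set ℝ) ∈ ae volume := compl_mem_ae_iff.2 (by simp)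
    filter_upwards [h1] with t ht
    simp only [mem_compl_iff, mem_singleton_iff] at ht
    apply propext
    change (s ≤ t ∧ 0 < t ∧ t < 1) ↔ (s < t ∧ t < 1)
    grind
  have hsub : Ioo s 1 ⊆ Ioo (0 : ℝ) 1 := Ioo_subset_Ioo_left hs
  have h1 := hp.jointLaw_succ_apply hΩm M hB
  rw [h1, Measure.restrict_congr_set hBs, ← lintegral_indicator
    (htm measurableSet_Ici)]
  change ∫⁻ z, (Ici s).indicator k (tail p z) ∂(lawOf p) = _
  rw [hp.lintegral_comp_tail (hkm.indicator measurableSet_Ici),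
    lintegral_indicator measurableSet_Ici, Measure.restrict_restrict measurableSet_Ici,
    Measure.restrict_congr_set hset, upperIntegral, ← integral_div,
    ofReal_integral_eq_lintegral_ofReal]
  · refine setLIntegral_congr_fun measurableSet_Ioo fun t ht => ?_
    have h0 : 0 ≤ 1 - t := by linarith [ht.2]
    rw [hk]
    dsimp only
    rw [← ENNReal.ofReal_mul' (by positivity), hZ']
    congr 1
    simp only [add_tsub_cancel_right]
    field_simp
  · exact (hZ.mono_set hsub).div_const _
  · filter_upwards [ae_restrict_mem measurableSet_Ioo] with t ht
    exact div_nonneg (weight_pos hΩpos (M + 1) (hsub ht)).le hK.le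

theorem IsPosDensity.jointLaw_sum_le (hp : IsPosDensity p) (hΩm : Measurable Ω)
    (hΩpos : ∀ t ∈ Ioo (0 : ℝ) 1, 0 < Ω t) {N : ℕ} (hN : 1 ≤ N)
    (hZ : IntegrableOn (fun t => Ω t * (1 - t) ^ (N - 1)) (Ioo (0 : ℝ) 1)) (y : ℝ) :
    (jointLaw p Ω N).real {u | ∑ n, u n ≤ y} =
      upperIntegral Ω N (tail p y) / upperIntegral Ω N 0 := by
  have h := hp.jointLaw_sum_mem hΩm hΩpos hN hZ measurableSet_Iic (hp.tail_nonneg y)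
    (hp.Iic_ae_eq y)
  simp only [mem_Iic] at h
  rw [measureReal_def, h, ENNReal.toReal_ofReal]
  refine div_nonneg (setIntegral_nonneg measurableSet_Ioo fun t ht => ?_)
    (upperIntegral_zero_pos hΩpos hZ).le
  exact (weight_pos hΩpos N (Ioo_subset_Ioo_left (hp.tail_nonneg y) ht)).le

theorem IsPosDensity.jointLaw_isProbabilityMeasure (hp : IsPosDensity p) (hΩm : Measurable Ω)
    (hΩpos : ∀ t ∈ Ioo (0 : ℝ) 1, 0 < Ω t) {N : ℕ} (hN : 1 ≤ N)
    (hZ : IntegrableOn (fun t => Ω t * (1 - t) ^ (N - 1)) (Ioo (0 : ℝ) 1)) :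
    IsProbabilityMeasure (jointLaw p Ω N) := by
  have hB : (univ : Set ℝ) = tail p ⁻¹' Ici 0 := by
    ext z
    simpa using hp.tail_nonneg z
  have h := hp.jointLaw_sum_mem hΩm hΩpos hN hZ MeasurableSet.univ le_rfl hB.eventuallyEq
  rw [div_self (upperIntegral_zero_pos hΩpos hZ).ne', ENNReal.ofReal_one] at h
  exact ⟨by simpa using h⟩

/-! ### Asymptotics of the integrals for large `N`. -/

theorem integrableOn_rpow_mul_exp_neg_half {a : ℝ} (ha : 0 < a) :
    IntegrableOn (fun y : ℝ => y ^ (a - 1) * Real.exp (-(y / 2))) (Ioi 0) := by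
  have := integrableOn_rpow_mul_exp_neg_mul_rpow (s := a - 1) (p := 1) (b := 1 / 2) (by linarith)
    one_pos (by norm_num)
  refine this.congr_fun (fun y _ => ?_) measurableSet_Ioi
  simp only [Real.rpow_one]
  ring_nf

/-- The part of `N^a ∫_s^1 Ω(t) (1 - t)^(N - 1) dt` near the origin, after the substitution
`t = y / N`. -/
theorem rescaled_integral (a : ℝ) {N : ℕ} (hN : 1 ≤ N) {s δ : ℝ} (hs : 0 ≤ s) :
    (N : ℝ) ^ a * ∫ t in Ioo s δ, Ω t * (1 - t) ^ (N - 1) =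
      ∫ y in Ioi (0 : ℝ), (N : ℝ) ^ (a - 1) *
        (Ioo s δ).indicator (fun t => Ω t * (1 - t) ^ (N - 1)) (y / N) := by
  have hN' : (0 : ℝ) < N := by exact_mod_cast hN
  have h := integral_comp_mul_left_Ioi
    ((Ioo s δ).indicator (fun t => Ω t * (1 - t) ^ (N - 1))) 0 (inv_pos.2 hN')
  have h2 : ∫ y in Ioi (0 : ℝ), (Ioo s δ).indicator (fun t => Ω t * (1 - t) ^ (N - 1)) y
      = ∫ t in Ioo s δ, Ω t * (1 - t) ^ (N - 1) := by
    rw [setIntegral_indicator measurableSet_Ioo,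
      inter_eq_self_of_subset_right fun t ht => mem_Ioi.2 (hs.trans_lt ht.1)]
  rw [mul_zero, h2, inv_inv, smul_eq_mul] at h
  simp_rw [div_eq_inv_mul]
  rw [integral_const_mul, h, ← mul_assoc, ← Real.rpow_add_one hN'.ne']
  congr 2
  ring

theorem tendsto_one_sub_div_pow_pred (y : ℝ) :
    Tendsto (fun N : ℕ => (1 - y / N) ^ (N - 1)) atTop (𝓝 (Real.exp (-y))) := by
  have h1 := Real.tendsto_one_add_div_pow_exp (-y)
  have h0 : Tendsto (fun N : ℕ => y / (N : ℝ)) atTop (𝓝 0) :=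
    tendsto_const_div_atTop_nhds_zero_nat y
  have h2 : Tendsto (fun N : ℕ => 1 - y / (N : ℝ)) atTop (𝓝 1) := by
    simpa using h0.const_sub 1
  have h3 := h1.div h2 one_ne_zero
  rw [div_one] at h3
  refine h3.congr' ?_
  filter_upwards [h2.eventually_ne one_ne_zero, eventually_ge_atTop 1] with N hN hN1
  obtain ⟨M, rfl⟩ : ∃ M, N = M + 1 := ⟨N - 1, by omega⟩
  simp only [Pi.div_apply, add_tsub_cancel_right, neg_div, ← sub_eq_add_neg]
  rw [pow_succ, mul_div_cancel_right₀ _ hN]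

/-- Dominated convergence in `y = N t`: one has `N^(a-1) Ω(y/N) → c y^(a-1)` and `(1 - y/N)^(N-1) →
e^{-y}`. The cutoff `δ` keeps `t` where `Ω` is bounded by twice its asymptotic form. -/
theorem tendsto_rescaled_integral {a c δ τ : ℝ} (ha : 0 < a) (hc : 0 < c) (hδ0 : 0 < δ)
    (hδ1 : δ ≤ 1) (hΩm : Measurable Ω) (hΩpos : ∀ t ∈ Ioo (0 : ℝ) 1, 0 < Ω t)
    (hΩ : Tendsto (fun t => Ω t / t ^ (a - 1)) (𝓝[>] 0) (𝓝 c))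
    (hδ : ∀ t ∈ Ioo 0 δ, Ω t ≤ 2 * c * t ^ (a - 1)) (hτ : 0 ≤ τ) {s : ℕ → ℝ}
    (hs : ∀ N, 0 ≤ s N) (hsτ : Tendsto (fun N : ℕ => N * s N) atTop (𝓝 τ)) :
    Tendsto (fun N : ℕ => (N : ℝ) ^ a * ∫ t in Ioo (s N) δ, Ω t * (1 - t) ^ (N - 1)) atTop
      (𝓝 (c * ∫ y in Ioi τ, y ^ (a - 1) * Real.exp (-y))) := by
  have hlim : c * ∫ y in Ioi τ, y ^ (a - 1) * Real.exp (-y)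
      = ∫ y in Ioi (0 : ℝ),
        (Ioi τ).indicator (fun y => c * (y ^ (a - 1) * Real.exp (-y))) y := by
    rw [setIntegral_indicator measurableSet_Ioi,
      inter_eq_self_of_subset_right (Ioi_subset_Ioi hτ), integral_const_mul]
  rw [hlim]
  have hdct : Tendsto (fun N : ℕ => ∫ y in Ioi (0 : ℝ), (N : ℝ) ^ (a - 1) *
        (Ioo (s N) δ).indicator (fun t => Ω t * (1 - t) ^ (N - 1)) (y / N)) atTop
      (𝓝 (∫ y in Ioi (0 : ℝ),
        (Ioi τ).indicator (fun y => c * (y ^ (a - 1) * Real.exp (-y))) y)) := by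
    refine tendsto_integral_filter_of_dominated_convergence
      (fun y => 2 * c * (y ^ (a - 1) * Real.exp (-(y / 2)))) ?_ ?_
      ((integrableOn_rpow_mul_exp_neg_half ha).const_mul _) ?_
    · refine Eventually.of_forall fun N => Measurable.aestronglyMeasurable ?_
      refine measurable_const.mul (Measurable.comp (Measurable.indicator ?_ measurableSet_Ioo) ?_)
      · fun_prop
      · fun_prop
    -- For `N ≥ 2` one has `(N-1)/N ≥ 1/2`, whence the dominating factor `e^{-y/2}`.
    · filter_upwards [eventually_ge_atTop 2] with N hN
      have hN2 : (2 : ℝ) ≤ N := by exact_mod_cast hN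
      filter_upwards [ae_restrict_mem measurableSet_Ioi] with y hy
      have hy : 0 < y := hy
      by_cases h : y / N ∈ Ioo (s N) δ
      · have ht0 : 0 < y / N := by positivity
        have ht : y / N ∈ Ioo 0 1 := ⟨ht0, h.2.trans_le hδ1⟩
        rw [indicator_of_mem h, Real.norm_of_nonneg
          (mul_nonneg (by positivity) (weight_pos hΩpos N ht).le)]
        have h1 : (1 - y / N) ^ (N - 1) ≤ Real.exp (-(y / 2)) := by
          calc (1 - y / N) ^ (N - 1) ≤ (Real.exp (-(y / N))) ^ (N - 1) :=
                pow_le_pow_left₀ (by linarith [ht.2]) (Real.one_sub_le_exp_neg _) _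
            _ = Real.exp (-(y / N * (N - 1))) := by
                rw [← Real.exp_nat_mul, Nat.cast_sub (by omega)]
                push_cast
                ring_nf
            _ ≤ Real.exp (-(y / 2)) := by
                rw [Real.exp_le_exp, neg_le_neg_iff, div_mul_eq_mul_div,
                  div_le_div_iff₀ (by norm_num) (by positivity)]
                nlinarith
        calc (N : ℝ) ^ (a - 1) * (Ω (y / N) * (1 - y / N) ^ (N - 1))
            ≤ (N : ℝ) ^ (a - 1) * (2 * c * (y / N) ^ (a - 1) * Real.exp (-(y / 2))) := by
              refine mul_le_mul_of_nonneg_left ?_ (by positivity)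
              exact mul_le_mul (hδ _ ⟨ht0, h.2⟩) h1
                (pow_nonneg (by linarith [ht.2]) _) (by positivity)
          _ = 2 * c * (y ^ (a - 1) * Real.exp (-(y / 2))) := by
              rw [Real.div_rpow hy.le (by positivity)]
              have : (N : ℝ) ^ (a - 1) ≠ 0 := (Real.rpow_pos_of_pos (by linarith) _).ne'
              field_simp
      · rw [indicator_of_notMem h, mul_zero, norm_zero]
        positivity
    -- At `y = τ` the indicators of `y/N > s_N` need not converge; this single point is null.
    · have hne : ({τ}ᶜ : Set ℝ) ∈ ae (volume.restrict (Ioi (0 : ℝ))) :=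
        compl_mem_ae_iff.2 (by simp)
      filter_upwards [ae_restrict_mem measurableSet_Ioi, hne] with y hy hyτ
      have hy : 0 < y := hy
      have hdiv : Tendsto (fun N : ℕ => y / (N : ℝ)) atTop (𝓝 0) :=
        tendsto_const_div_atTop_nhds_zero_nat y
      rcases lt_or_gt_of_ne hyτ with h | h
      · rw [indicator_of_notMem (show y ∉ Ioi τ from not_lt.2 h.le)]
        refine tendsto_const_nhds.congr' ?_
        filter_upwards [hsτ.eventually_const_lt h, eventually_ge_atTop 1] with N hN hN1
        have hN' : (0 : ℝ) < N := by exact_mod_cast hN1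
        rw [indicator_of_notMem, mul_zero]
        intro hm
        have := (lt_div_iff₀ hN').1 hm.1
        linarith
      · rw [indicator_of_mem (show y ∈ Ioi τ from h)]
        have hdiv' : Tendsto (fun N : ℕ => y / (N : ℝ)) atTop (𝓝[>] 0) := by
          refine tendsto_nhdsWithin_iff.2 ⟨hdiv, ?_⟩
          filter_upwards [eventually_ge_atTop 1] with N hN1
          have hN' : (0 : ℝ) < N := by exact_mod_cast hN1
          exact div_pos hy hN'
        refine ((hΩ.comp hdiv').mul ((tendsto_one_sub_div_pow_pred y).const_mul
          (y ^ (a - 1)))).congr' ?_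
        filter_upwards [hsτ.eventually_lt_const h, eventually_ge_atTop 1,
          hdiv.eventually_lt_const hδ0] with N hN hN1 hNδ
        have hN' : (0 : ℝ) < N := by exact_mod_cast hN1
        rw [indicator_of_mem (show y / N ∈ Ioo (s N) δ from
          ⟨(lt_div_iff₀ hN').2 (by linarith), hNδ⟩), Function.comp_apply,
          Real.div_rpow hy.le hN'.le]
        have : (N : ℝ) ^ (a - 1) ≠ 0 := (Real.rpow_pos_of_pos hN' _).ne'
        have : y ^ (a - 1) ≠ 0 := (Real.rpow_pos_of_pos hy _).ne'
        field_simp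
  refine hdct.congr' ?_
  filter_upwards [eventually_ge_atTop 1] with N hN
  exact (rescaled_integral a hN (hs N)).symm

theorem tendsto_rpow_mul_pow_sub {a r : ℝ} (hr0 : 0 < r) (hr1 : r < 1) (m : ℕ) :
    Tendsto (fun N : ℕ => (N : ℝ) ^ a * r ^ (N - m)) atTop (𝓝 0) := by
  have h := (tendsto_pow_const_mul_const_pow_of_abs_lt_one ⌈a⌉₊
    (by rwa [abs_of_pos hr0])).const_mul ((r ^ m)⁻¹)
  rw [mul_zero] at h
  refine squeeze_zero' (Eventually.of_forall fun N => by positivity) ?_ h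
  filter_upwards [eventually_ge_atTop (max 1 m)] with N hN
  have hN1 : (1 : ℝ) ≤ N := by exact_mod_cast (le_max_left _ _).trans hN
  have h1 : (N : ℝ) ^ a ≤ (N : ℝ) ^ ⌈a⌉₊ := by
    rw [← Real.rpow_natCast]
    exact Real.rpow_le_rpow_of_exponent_le hN1 (Nat.le_ceil a)
  rw [pow_sub₀ _ hr0.ne' ((le_max_right _ _).trans hN)]
  have h2 : 0 ≤ r ^ N * (r ^ m)⁻¹ := by positivity
  calc (N : ℝ) ^ a * (r ^ N * (r ^ m)⁻¹) ≤ (N : ℝ) ^ ⌈a⌉₊ * (r ^ N * (r ^ m)⁻¹) :=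
        mul_le_mul_of_nonneg_right h1 h2
    _ = _ := by ring

/-- The part over `t ≥ δ` is at most `(1-δ)^(N-N₀)` times the finite integral for `N₀`, so it beats
`N^a` even though `Ω` is not assumed bounded there. -/
theorem tendsto_rpow_mul_upperIntegral {a c τ : ℝ} (ha : 0 < a) (hc : 0 < c)
    (hΩm : Measurable Ω) (hΩpos : ∀ t ∈ Ioo (0 : ℝ) 1, 0 < Ω t)
    (hΩ : Tendsto (fun t => Ω t / t ^ (a - 1)) (𝓝[>] 0) (𝓝 c)) {N₀ : ℕ} (hN₀ : 1 ≤ N₀)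
    (hZ : IntegrableOn (fun t => Ω t * (1 - t) ^ (N₀ - 1)) (Ioo (0 : ℝ) 1))
    (hτ : 0 ≤ τ) {s : ℕ → ℝ}
    (hs : ∀ N, 0 ≤ s N) (hsτ : Tendsto (fun N : ℕ => N * s N) atTop (𝓝 τ)) :
    Tendsto (fun N : ℕ => (N : ℝ) ^ a * upperIntegral Ω N (s N)) atTop
      (𝓝 (c * ∫ y in Ioi τ, y ^ (a - 1) * Real.exp (-y))) := by
  obtain ⟨δ, hδ0, hδ1, hδ⟩ : ∃ δ : ℝ, 0 < δ ∧ δ < 1 ∧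
      ∀ t ∈ Ioo 0 δ, Ω t ≤ 2 * c * t ^ (a - 1) := by
    have h := hΩ.eventually_lt_const (show c < 2 * c by linarith)
    obtain ⟨u, hu, hsub⟩ := (mem_nhdsGT_iff_exists_Ioo_subset).1 h
    refine ⟨min u (1 / 2), lt_min hu (by norm_num), by
      linarith [min_le_right u (1 / 2)], fun t ht => ?_⟩
    have h1 := hsub ⟨ht.1, ht.2.trans_le (min_le_left _ _)⟩
    exact ((div_lt_iff₀ (Real.rpow_pos_of_pos ht.1 _)).1 h1).le
  have hA := tendsto_rescaled_integral ha hc hδ0 hδ1.le hΩm hΩpos hΩ hδ hτ hs hsτ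
  have hs0 : Tendsto s atTop (𝓝 0) := by
    have h1 := hsτ.mul (tendsto_inv_atTop_nhds_zero_nat (𝕜 := ℝ))
    rw [mul_zero] at h1
    refine h1.congr' ?_
    filter_upwards [eventually_ge_atTop 1] with N hN1
    have hN' : (N : ℝ) ≠ 0 := by positivity
    field_simp
  set C := ∫ t in Ioo (0 : ℝ) 1, Ω t * (1 - t) ^ (N₀ - 1)
  have hB : Tendsto (fun N : ℕ => (N : ℝ) ^ a * ∫ t in Ico δ 1, Ω t * (1 - t) ^ (N - 1))
      atTop (𝓝 0) := by
    have h := (tendsto_rpow_mul_pow_sub (a := a) (r := 1 - δ) (by linarith) (by linarith)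
      N₀).mul_const C
    rw [zero_mul] at h
    have hsub : Ico δ 1 ⊆ Ioo (0 : ℝ) 1 := fun t ht => ⟨hδ0.trans_le ht.1, ht.2⟩
    refine squeeze_zero' (Eventually.of_forall fun N => ?_) ?_ h
    · exact mul_nonneg (by positivity) (setIntegral_nonneg measurableSet_Ico
        fun t ht => (weight_pos hΩpos N (hsub ht)).le)
    · filter_upwards [eventually_ge_atTop (max N₀ 1)] with N hN
      have hN0 := (le_max_left _ _).trans hN
      have hN1 := (le_max_right _ _).trans hN
      rw [mul_assoc]
      refine mul_le_mul_of_nonneg_left ?_ (by positivity)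
      calc ∫ t in Ico δ 1, Ω t * (1 - t) ^ (N - 1)
          ≤ ∫ t in Ico δ 1, (1 - δ) ^ (N - N₀) * (Ω t * (1 - t) ^ (N₀ - 1)) := by
            refine setIntegral_mono_on ((integrableOn_weight hΩm hN0 hZ).mono_set hsub)
              ((hZ.mono_set hsub).const_mul _) measurableSet_Ico fun t ht => ?_
            have ht1 : 0 ≤ 1 - t := by linarith [ht.2]
            have ht2 : 1 - t ≤ 1 := by linarith [ht.1]
            have h3 : (1 - t) ^ (N - 1) ≤ (1 - t) ^ (N - N₀) * (1 - t) ^ (N₀ - 1) := by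
              have h : N - N₀ + (N₀ - 1) ≤ N - 1 := by omega
              rw [← pow_add]
              exact pow_le_pow_of_le_one ht1 ht2 h
            have h4 : (1 - t) ^ (N - N₀) ≤ (1 - δ) ^ (N - N₀) :=
              pow_le_pow_left₀ ht1 (by linarith [ht.1]) _
            have h5 : 0 ≤ (1 - t) ^ (N₀ - 1) := by positivity
            have h6 := (hΩpos t (hsub ht)).le
            calc Ω t * (1 - t) ^ (N - 1) ≤ Ω t * ((1 - δ) ^ (N - N₀) * (1 - t) ^ (N₀ - 1)) :=
                  mul_le_mul_of_nonneg_left (h3.trans (mul_le_mul_of_nonneg_right h4 h5)) h6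
              _ = _ := by ring
        _ = (1 - δ) ^ (N - N₀) * ∫ t in Ico δ 1, Ω t * (1 - t) ^ (N₀ - 1) :=
            integral_const_mul _ _
        _ ≤ (1 - δ) ^ (N - N₀) * C := by
            refine mul_le_mul_of_nonneg_left ?_ (pow_nonneg (by linarith) _)
            refine setIntegral_mono_set hZ ?_ hsub.eventuallyLE
            filter_upwards [ae_restrict_mem measurableSet_Ioo] with t ht using
              (weight_pos hΩpos N₀ ht).le
  have hAB := hA.add hB
  rw [add_zero] at hAB
  refine hAB.congr' ?_
  filter_upwards [hs0.eventually_lt_const hδ0, eventually_ge_atTop N₀] with N hN hN0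
  have hI := integrableOn_weight hΩm hN0 hZ
  rw [← mul_add, upperIntegral, ← Ioo_union_Ico_eq_Ioo hN hδ1.le, setIntegral_union]
  · exact disjoint_left.2 fun t h1 h2 => not_lt.2 h2.1 h1.2
  · exact measurableSet_Ico
  · exact hI.mono_set fun t ht => ⟨(hs N).trans_lt ht.1, ht.2.trans hδ1⟩
  · exact hI.mono_set fun t ht => ⟨hδ0.trans_le ht.1, ht.2⟩

/-! ### The Gamma limit law. -/

open ProbabilityTheory in
theorem gammaMeasure_real_Ioi {a τ : ℝ} (ha : 0 < a) (hτ : 0 ≤ τ) :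
    (gammaMeasure a 1).real (Ioi τ) =
      (∫ y in Ioi τ, y ^ (a - 1) * Real.exp (-y)) / Real.Gamma a := by
  have hnn : ∀ y ∈ Ioi τ, 0 ≤ y ^ (a - 1) * Real.exp (-y) / Real.Gamma a := fun y hy => by
    have : 0 < y := hτ.trans_lt hy
    have := Real.Gamma_pos_of_pos ha
    positivity
  rw [measureReal_def, gammaMeasure, withDensity_apply _ measurableSet_Ioi, ← integral_div,
    integral_eq_lintegral_of_nonneg_ae]
  · congr 1
    refine setLIntegral_congr_fun measurableSet_Ioi fun y hy => ?_
    rw [gammaPDF_of_nonneg (hτ.trans_lt hy).le]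
    simp only [Real.one_rpow, one_mul]
    congr 1
    ring
  · filter_upwards [ae_restrict_mem measurableSet_Ioi] with y hy using hnn y hy
  · exact Measurable.aestronglyMeasurable (by fun_prop)

open ProbabilityTheory in
/-- If `N s_N → τ`, then the ratio of `∫_{s_N}^1 Ω(t) (1 - t)^(N - 1) dt` to the full integral
tends to the probability that a Gamma variable of shape `a` exceeds `τ`. -/
theorem tendsto_upperIntegral_ratio {a c τ : ℝ} (ha : 0 < a) (hc : 0 < c)
    (hΩm : Measurable Ω) (hΩpos : ∀ t ∈ Ioo (0 : ℝ) 1, 0 < Ω t)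
    (hΩ : Tendsto (fun t => Ω t / t ^ (a - 1)) (𝓝[>] 0) (𝓝 c)) {N₀ : ℕ} (hN₀ : 1 ≤ N₀)
    (hZ : IntegrableOn (fun t => Ω t * (1 - t) ^ (N₀ - 1)) (Ioo (0 : ℝ) 1))
    (hτ : 0 ≤ τ) {s : ℕ → ℝ}
    (hs : ∀ N, 0 ≤ s N) (hsτ : Tendsto (fun N : ℕ => N * s N) atTop (𝓝 τ)) :
    Tendsto (fun N : ℕ => upperIntegral Ω N (s N) / upperIntegral Ω N 0) atTop
      (𝓝 ((gammaMeasure a 1).real (Ioi τ))) := by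
  have h1 := tendsto_rpow_mul_upperIntegral ha hc hΩm hΩpos hΩ hN₀ hZ hτ hs hsτ
  have h2 := tendsto_rpow_mul_upperIntegral ha hc hΩm hΩpos hΩ hN₀ hZ le_rfl (s := fun _ => 0)
    (fun _ => le_rfl) (by simp)
  have hG : ∫ y in Ioi (0 : ℝ), y ^ (a - 1) * Real.exp (-y) = Real.Gamma a := by
    rw [Real.Gamma_eq_integral ha]
    simp_rw [mul_comm]
  have hGpos := Real.Gamma_pos_of_pos ha
  rw [hG] at h2
  have h3 := h1.div h2 (mul_pos hc hGpos).ne'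
  rw [mul_div_mul_left _ _ hc.ne', ← gammaMeasure_real_Ioi ha hτ] at h3
  refine h3.congr' ?_
  filter_upwards [eventually_ge_atTop 1] with N hN1
  have hN' : (0 : ℝ) < N := by exact_mod_cast hN1
  exact mul_div_mul_left _ _ (Real.rpow_pos_of_pos hN' _).ne'

open ProbabilityTheory in
theorem gammaMeasure_Ioi_zero {a : ℝ} (ha : 0 < a) : gammaMeasure a 1 (Ioi 0) = 1 := by
  have := isProbabilityMeasure_gammaMeasure ha one_pos
  have h : (gammaMeasure a 1).real (Ioi 0) = 1 := by
    rw [gammaMeasure_real_Ioi ha le_rfl, Real.Gamma_eq_integral ha]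
    simp_rw [mul_comm]
    refine div_self ?_
    have := (Real.Gamma_pos_of_pos ha).ne'
    rw [Real.Gamma_eq_integral ha] at this
    simpa only [mul_comm] using this
  rw [← ofReal_measureReal, h, ENNReal.ofReal_one]

open ProbabilityTheory in
theorem gammaMeasure_Ici (a τ : ℝ) : gammaMeasure a 1 (Ici τ) = gammaMeasure a 1 (Ioi τ) := by
  have : NullSingletonClass (gammaMeasure a 1) := by
    unfold gammaMeasure; infer_instance
  exact measure_congr Ioi_ae_eq_Ici.symm

/-! ### The three limit densities as pullbacks of the Gamma density. -/

open ProbabilityTheory in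
/-- A density obtained from the Gamma density by a change of variables on `D`. -/
theorem lawOf_apply_eq_gammaMeasure_image {h τ τ' : ℝ → ℝ} {a : ℝ} {D : Set ℝ}
    (hD : MeasurableSet D) (hτ : ∀ x ∈ D, HasDerivAt τ (τ' x) x) (hinj : InjOn τ D)
    (hh : ∀ x ∈ D, h x = |τ' x| * gammaPDFReal a 1 (τ x)) (hh0 : ∀ x, x ∉ D → h x = 0)
    {S : Set ℝ} (hS : MeasurableSet S) :
    lawOf h S = gammaMeasure a 1 (τ '' (S ∩ D)) := by
  have hτS : ∀ x ∈ S ∩ D, HasDerivWithinAt τ (τ' x) (S ∩ D) x :=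
    fun x hx => (hτ x hx.2).hasDerivWithinAt
  have hinjS : InjOn τ (S ∩ D) := hinj.mono inter_subset_right
  have him : MeasurableSet (τ '' (S ∩ D)) :=
    measurable_image_of_fderivWithin (hS.inter hD) (fun x hx => (hτS x hx).hasFDerivWithinAt) hinjS
  rw [gammaMeasure, withDensity_apply _ him,
    lintegral_image_eq_lintegral_abs_deriv_mul (hS.inter hD) hτS hinjS,
    lawOf, withDensity_apply _ hS, ← lintegral_indicator hS,
    ← lintegral_indicator (hS.inter hD)]
  refine lintegral_congr fun x => ?_
  by_cases hxS : x ∈ S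
  · by_cases hxD : x ∈ D
    · rw [indicator_of_mem hxS, indicator_of_mem (mem_inter hxS hxD), hh x hxD,
        ENNReal.ofReal_mul (abs_nonneg _), gammaPDF]
    · rw [indicator_of_mem hxS, indicator_of_notMem fun h => hxD h.2, hh0 x hxD,
        ENNReal.ofReal_zero]
  · rw [indicator_of_notMem hxS, indicator_of_notMem fun h => hxS h.1]

theorem hasDerivAt_gumbel (a θ ν x : ℝ) :
    HasDerivAt (fun x => a * Real.exp (-θ * (x + ν))) (-(θ * (a * Real.exp (-θ * (x + ν))))) x := by
  have h1 : HasDerivAt (fun x => -θ * (x + ν)) (-θ) x := by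
    simpa using ((hasDerivAt_id x).add_const ν).const_mul (-θ)
  exact (h1.exp.const_mul a).congr_deriv (by ring)

theorem lawOf_gumbelPDF_apply {a : ℝ} (ha : 0 < a) {S : Set ℝ} (hS : MeasurableSet S) :
    lawOf (gumbelPDF a) S = ProbabilityTheory.gammaMeasure a 1
      ((fun x => a * Real.exp (-gumbelTheta a * (x + gumbelNu a))) '' S) := by
  have hθ := gumbelTheta_pos ha
  have := lawOf_apply_eq_gammaMeasure_image (h := gumbelPDF a) (a := a) MeasurableSet.univ
    (fun x _ => hasDerivAt_gumbel a (gumbelTheta a) (gumbelNu a) x) ?_ ?_ (by simp) hS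
  · rwa [inter_univ] at this
  · intro x _ y _ h
    have h1 := Real.exp_injective (mul_left_cancel₀ ha.ne' h)
    have := mul_left_cancel₀ (neg_ne_zero.2 hθ.ne') h1
    linarith
  · intro x _
    set θ := gumbelTheta a
    set ν := gumbelNu a
    have he := Real.exp_pos (-θ * (x + ν))
    rw [abs_neg, abs_of_nonneg (by positivity), ProbabilityTheory.gammaPDFReal,
      if_pos (by positivity), gumbelPDF, Real.mul_rpow ha.le he.le, sub_eq_add_neg, Real.exp_add,
      ← Real.exp_mul]
    -- One factor `e^{-θ(x+ν)}` belongs to the Jacobian; the other `a - 1` come from the Gamma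
    -- density.
    have h1 : Real.exp (-a * θ * (x + ν)) =
        Real.exp (-θ * (x + ν) * (a - 1)) * Real.exp (-θ * (x + ν)) := by
      rw [← Real.exp_add]; ring_nf
    have h2 : a ^ a = a ^ (a - 1) * a := by
      rw [← Real.rpow_add_one ha.ne']; ring_nf
    change a ^ a * θ / Real.Gamma a * (Real.exp (-a * θ * (x + ν)) * _) = _
    rw [h1, h2, Real.one_rpow, one_mul]
    ring

theorem lawOf_gumbelPDF_univ {a : ℝ} (ha : 0 < a) : lawOf (gumbelPDF a) univ = 1 := by
  have hθ := gumbelTheta_pos ha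
  rw [lawOf_gumbelPDF_apply ha MeasurableSet.univ, ← gammaMeasure_Ioi_zero ha]
  congr 1
  ext y
  simp only [image_univ, mem_range, mem_Ioi]
  constructor
  · rintro ⟨x, rfl⟩
    positivity
  · intro hy
    refine ⟨-(Real.log (y / a) / gumbelTheta a) - gumbelNu a, ?_⟩
    have : -gumbelTheta a * (-(Real.log (y / a) / gumbelTheta a) - gumbelNu a + gumbelNu a)
        = Real.log (y / a) := by
      field_simp
      ring
    rw [this, Real.exp_log (by positivity)]
    field_simp

/-- The change of variables is decreasing, so `Iic x` maps onto the half-line above its value at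
`x`. The same holds in the Fréchet and Weibull cases below. -/
theorem lawOf_gumbelPDF_Iic {a : ℝ} (ha : 0 < a) (x : ℝ) :
    lawOf (gumbelPDF a) (Iic x) = ProbabilityTheory.gammaMeasure a 1
      (Ioi (a * Real.exp (-gumbelTheta a * (x + gumbelNu a)))) := by
  have hθ := gumbelTheta_pos ha
  rw [lawOf_gumbelPDF_apply ha measurableSet_Iic, ← gammaMeasure_Ici]
  congr 1
  ext y
  simp only [mem_image, mem_Iic, mem_Ici]
  constructor
  · rintro ⟨z, hz, rfl⟩
    refine mul_le_mul_of_nonneg_left (Real.exp_le_exp.2 ?_) ha.le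
    nlinarith
  · intro hy
    have hy0 : 0 < y := lt_of_lt_of_le (by positivity) hy
    have h1 : -gumbelTheta a * (-(Real.log (y / a) / gumbelTheta a) - gumbelNu a + gumbelNu a)
        = Real.log (y / a) := by
      field_simp
      ring
    refine ⟨-(Real.log (y / a) / gumbelTheta a) - gumbelNu a, ?_, ?_⟩
    · have h2 : -gumbelTheta a * (x + gumbelNu a) ≤ Real.log (y / a) := by
        rw [Real.le_log_iff_exp_le (by positivity), le_div_iff₀ ha]
        linarith
      rw [← h1] at h2
      by_contra h
      nlinarith [mul_lt_mul_of_pos_left (not_le.1 h) hθ]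
    · rw [h1, Real.exp_log (by positivity)]
      field_simp

theorem lawOf_frechetPDF_apply {a μ : ℝ} (ha : 0 < a) (hμ : 0 < μ) {S : Set ℝ}
    (hS : MeasurableSet S) :
    lawOf (frechetPDF a μ) S = ProbabilityTheory.gammaMeasure a 1
      ((fun x => frechetScale a μ * x ^ (-μ)) '' (S ∩ Ioi 0)) := by
  have hl := frechetScale_pos ha hμ
  set l := frechetScale a μ with hldef
  refine lawOf_apply_eq_gammaMeasure_image (h := frechetPDF a μ) (a := a) measurableSet_Ioi
    (τ' := fun x => l * (-μ * x ^ (-μ - 1))) (fun x hx => ?_) ?_ ?_ ?_ hS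
  · exact (Real.hasDerivAt_rpow_const (Or.inl (ne_of_gt hx))).const_mul l
  · intro x hx y hy h
    exact (Real.rpow_left_inj (le_of_lt hx) (le_of_lt hy) (neg_ne_zero.2 hμ.ne')).1
      (mul_left_cancel₀ hl.ne' h)
  · intro x hx
    have hx : 0 < x := hx
    have h0 : |l * (-μ * x ^ (-μ - 1))| = l * (μ * x ^ (-μ - 1)) := by
      rw [neg_mul, mul_neg, abs_neg, abs_of_nonneg (by positivity)]
    rw [h0, ProbabilityTheory.gammaPDFReal, if_pos (by positivity), frechetPDF, if_pos hx,
      ← hldef, Real.mul_rpow hl.le (by positivity), ← Real.rpow_mul hx.le, one_div,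
      ← Real.rpow_neg hx.le]
    have h1 : x ^ (-(1 + a * μ)) = x ^ (-μ * (a - 1)) * x ^ (-μ - 1) := by
      rw [← Real.rpow_add hx]; ring_nf
    have h2 : l ^ a = l ^ (a - 1) * l := by
      rw [← Real.rpow_add_one hl.ne']; ring_nf
    rw [h1, h2, Real.one_rpow, one_mul, neg_mul]
    ring_nf
  · intro x hx
    rw [frechetPDF, if_neg (show ¬ 0 < x from hx)]

theorem frechet_inverse {l μ y : ℝ} (hl : 0 < l) (hμ : 0 < μ) (hy : 0 < y) :
    l * ((l / y) ^ (1 / μ)) ^ (-μ) = y := by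
  rw [← Real.rpow_mul (by positivity), show 1 / μ * -μ = -1 by field_simp, Real.rpow_neg_one]
  field_simp

theorem lawOf_frechetPDF_univ {a μ : ℝ} (ha : 0 < a) (hμ : 0 < μ) :
    lawOf (frechetPDF a μ) univ = 1 := by
  have hl := frechetScale_pos ha hμ
  rw [lawOf_frechetPDF_apply ha hμ MeasurableSet.univ, ← gammaMeasure_Ioi_zero ha, univ_inter]
  congr 1
  ext y
  simp only [mem_image, mem_Ioi]
  constructor
  · rintro ⟨x, hx, rfl⟩
    positivity
  · intro hy
    exact ⟨_, by positivity, frechet_inverse hl hμ hy⟩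

theorem lawOf_frechetPDF_Iic {a μ : ℝ} (ha : 0 < a) (hμ : 0 < μ) {x : ℝ} (hx : 0 < x) :
    lawOf (frechetPDF a μ) (Iic x) = ProbabilityTheory.gammaMeasure a 1
      (Ioi (frechetScale a μ * x ^ (-μ))) := by
  have hl := frechetScale_pos ha hμ
  rw [lawOf_frechetPDF_apply ha hμ measurableSet_Iic, ← gammaMeasure_Ici]
  congr 1
  ext y
  simp only [mem_image, mem_inter_iff, mem_Iic, mem_Ioi, mem_Ici]
  constructor
  · rintro ⟨z, ⟨hz, hz0⟩, rfl⟩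
    exact mul_le_mul_of_nonneg_left
      (Real.rpow_le_rpow_of_nonpos hz0 hz (by linarith)) hl.le
  · intro hy
    have hy0 : 0 < y := lt_of_lt_of_le (by positivity) hy
    have h := frechet_inverse hl hμ hy0
    refine ⟨_, ⟨?_, by positivity⟩, h⟩
    by_contra hlt
    have := Real.rpow_lt_rpow_of_neg hx (not_le.1 hlt) (neg_lt_zero.2 hμ)
    nlinarith [mul_lt_mul_of_pos_left this hl]

theorem lawOf_frechetPDF_Iic_of_nonpos {a μ : ℝ} (ha : 0 < a) (hμ : 0 < μ) {x : ℝ} (hx : x ≤ 0) :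
    lawOf (frechetPDF a μ) (Iic x) = 0 := by
  rw [lawOf_frechetPDF_apply ha hμ measurableSet_Iic, Iic_inter_Ioi, Ioc_eq_empty (not_lt.2 hx),
    image_empty, measure_empty]

theorem lawOf_weibullPDF_apply {a μ : ℝ} (ha : 0 < a) (hμ : 0 < μ) {S : Set ℝ}
    (hS : MeasurableSet S) :
    lawOf (weibullPDF a μ) S = ProbabilityTheory.gammaMeasure a 1
      ((fun x => weibullScale a μ * (-x) ^ μ) '' (S ∩ Iio 0)) := by
  have hl := weibullScale_pos ha hμ
  set l := weibullScale a μ with hldef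
  refine lawOf_apply_eq_gammaMeasure_image (h := weibullPDF a μ) (a := a) measurableSet_Iio
    (τ' := fun x => l * -(μ * (-x) ^ (μ - 1))) (fun x hx => ?_) ?_ ?_ ?_ hS
  · have hx : x < 0 := hx
    have h := ((hasDerivAt_neg x).rpow_const (p := μ) (Or.inl (neg_ne_zero.2 hx.ne))).const_mul l
    exact h.congr_deriv (by ring)
  · intro x hx y hy h
    have hx : x < 0 := hx
    have hy : y < 0 := hy
    exact neg_injective ((Real.rpow_left_inj (by linarith) (by linarith) hμ.ne').1
      (mul_left_cancel₀ hl.ne' h))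
  · intro x hx
    have hx' : x < 0 := hx
    have hx : 0 < -x := by linarith
    have h0 : |l * -(μ * (-x) ^ (μ - 1))| = l * (μ * (-x) ^ (μ - 1)) := by
      rw [mul_neg, abs_neg, abs_of_nonneg (by positivity)]
    rw [h0, ProbabilityTheory.gammaPDFReal, if_pos (by positivity), weibullPDF, if_pos hx',
      ← hldef, Real.mul_rpow hl.le (by positivity), ← Real.rpow_mul hx.le]
    have h1 : (-x) ^ (μ * a - 1) = (-x) ^ (μ * (a - 1)) * (-x) ^ (μ - 1) := by
      rw [← Real.rpow_add hx]; ring_nf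
    have h2 : l ^ a = l ^ (a - 1) * l := by
      rw [← Real.rpow_add_one hl.ne']; ring_nf
    rw [h1, h2, Real.one_rpow, one_mul, neg_mul]
    ring
  · intro x hx
    rw [weibullPDF, if_neg (show ¬ x < 0 from hx)]

theorem weibull_inverse {l μ y : ℝ} (hl : 0 < l) (hμ : 0 < μ) (hy : 0 < y) :
    l * (- -(y / l) ^ (1 / μ)) ^ μ = y := by
  rw [neg_neg, ← Real.rpow_mul (by positivity), one_div_mul_cancel hμ.ne', Real.rpow_one]
  field_simp

theorem weibull_image_Iio {l μ : ℝ} (hl : 0 < l) (hμ : 0 < μ) :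
    (fun x => l * (-x) ^ μ) '' Iio 0 = Ioi 0 := by
  ext y
  simp only [mem_image, mem_Ioi, mem_Iio]
  constructor
  · rintro ⟨x, hx, rfl⟩
    have : 0 < -x := by linarith
    positivity
  · intro hy
    refine ⟨_, ?_, weibull_inverse hl hμ hy⟩
    rw [neg_lt_zero]
    positivity

theorem lawOf_weibullPDF_univ {a μ : ℝ} (ha : 0 < a) (hμ : 0 < μ) :
    lawOf (weibullPDF a μ) univ = 1 := by
  rw [lawOf_weibullPDF_apply ha hμ MeasurableSet.univ, univ_inter,
    weibull_image_Iio (weibullScale_pos ha hμ) hμ, gammaMeasure_Ioi_zero ha]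

theorem lawOf_weibullPDF_Iic_of_nonneg {a μ : ℝ} (ha : 0 < a) (hμ : 0 < μ) {x : ℝ} (hx : 0 ≤ x) :
    lawOf (weibullPDF a μ) (Iic x) = ProbabilityTheory.gammaMeasure a 1 (Ioi 0) := by
  have h : Iic x ∩ Iio 0 = Iio 0 :=
    inter_eq_self_of_subset_right fun y hy => le_of_lt (lt_of_lt_of_le hy hx)
  rw [lawOf_weibullPDF_apply ha hμ measurableSet_Iic, h,
    weibull_image_Iio (weibullScale_pos ha hμ) hμ]

theorem lawOf_weibullPDF_Iic {a μ : ℝ} (ha : 0 < a) (hμ : 0 < μ) {x : ℝ} (hx : x < 0) :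
    lawOf (weibullPDF a μ) (Iic x) = ProbabilityTheory.gammaMeasure a 1
      (Ioi (weibullScale a μ * (-x) ^ μ)) := by
  have hl := weibullScale_pos ha hμ
  have hx0 : 0 < -x := by linarith
  rw [lawOf_weibullPDF_apply ha hμ measurableSet_Iic, ← gammaMeasure_Ici]
  congr 1
  ext y
  simp only [mem_image, mem_inter_iff, mem_Iic, mem_Iio, mem_Ici]
  constructor
  · rintro ⟨z, ⟨hz, hz0⟩, rfl⟩
    exact mul_le_mul_of_nonneg_left (Real.rpow_le_rpow hx0.le (by linarith) hμ.le) hl.le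
  · intro hy
    have hy0 : 0 < y := lt_of_lt_of_le (by positivity) hy
    have h := weibull_inverse hl hμ hy0
    have hpos : 0 < (y / weibullScale a μ) ^ (1 / μ) := by positivity
    refine ⟨_, ⟨?_, by rw [neg_lt_zero]; positivity⟩, h⟩
    by_contra hlt
    have := Real.rpow_lt_rpow (by rw [neg_neg]; positivity) (neg_lt_neg (not_le.1 hlt)) hμ
    nlinarith [mul_lt_mul_of_pos_left this hl]

/-! ### Reduction to the asymptotics of the tail. -/

/-- A sufficient condition for the convergence of the rescaled sum: `N F̃(α_N + β_N x)` converges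
to the level at which the survival function of the Gamma law equals the limit law at `x`. -/
theorem IsPosDensity.rescaledSumTendsto (hp : IsPosDensity p) {a c : ℝ}
    (ha : 0 < a) (hc : 0 < c)
    (hΩm : Measurable Ω) (hΩpos : ∀ t ∈ Ioo (0 : ℝ) 1, 0 < Ω t)
    (hΩ : Tendsto (fun t => Ω t / t ^ (a - 1)) (𝓝[>] 0) (𝓝 c)) {N₀ : ℕ} (hN₀ : 1 ≤ N₀)
    (hZ : IntegrableOn (fun t => Ω t * (1 - t) ^ (N₀ - 1)) (Ioo (0 : ℝ) 1))
    {h : ℝ → ℝ} (hh : lawOf h univ = 1) {α β : ℕ → ℝ} (hβ : ∀ N, 0 < β N)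
    (H : ∀ x, (∃ τ, 0 ≤ τ ∧ Tendsto (fun N : ℕ => N * tail p (α N + β N * x)) atTop (𝓝 τ) ∧
        lawOf h (Iic x) = ProbabilityTheory.gammaMeasure a 1 (Ioi τ)) ∨
      ((∀ N, tail p (α N + β N * x) = 1) ∧ lawOf h (Iic x) = 0)) :
    RescaledSumTendsto (jointLaw p Ω) h := by
  refine ⟨⟨hh⟩, α, β, hβ, fun x => ?_⟩
  have hP : (fun N : ℕ => upperIntegral Ω N (tail p (α N + β N * x)) / upperIntegral Ω N 0)
      =ᶠ[atTop] fun N => (jointLaw p Ω N).real {u | ∑ n, u n ≤ α N + β N * x} := by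
    filter_upwards [eventually_ge_atTop N₀] with N hN
    exact (hp.jointLaw_sum_le hΩm hΩpos (hN₀.trans hN) (integrableOn_weight hΩm hN hZ) _).symm
  refine Tendsto.congr' hP ?_
  rcases H x with ⟨τ, hτ, hlim, hl⟩ | ⟨h1, hl⟩
  · rw [measureReal_def, hl]
    exact tendsto_upperIntegral_ratio ha hc hΩm hΩpos hΩ hN₀ hZ hτ
      (fun N => hp.tail_nonneg _) hlim
  -- This is the case `τ = ∞`, met by the Fréchet law at `x ≤ 0`: the integral from `F̃ = 1` to `1`
  -- is empty.
  · rw [measureReal_def, hl]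
    simp [h1, upperIntegral]

/-! ### Tails of densities with power behaviour. -/

/-- Karamata's theorem for a density with a power tail. -/
theorem tendsto_rpow_mul_tail {μ c : ℝ} (hpm : Measurable p) (hpn : ∀ z, 0 ≤ p z) (hμ : 0 < μ)
    (hc : 0 < c) (h : Tendsto (fun z => p z / z ^ (-1 - μ)) atTop (𝓝 c)) :
    Tendsto (fun z => z ^ μ * tail p z) atTop (𝓝 (c / μ)) := by
  have hint : ∫ s in Ioi (1 : ℝ), c * s ^ (-1 - μ) = c / μ := by
    rw [integral_const_mul, integral_Ioi_rpow_of_lt (by linarith) one_pos, Real.one_rpow,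
      show -1 - μ + 1 = -μ by ring]
    field_simp
  rw [← hint]
  -- The scaling `y = z s` fixes the domain `s > 1`; once `z` is large, `2c s^(-1-μ)` dominates
  -- uniformly in `z`.
  have hdct : Tendsto (fun z : ℝ => ∫ s in Ioi (1 : ℝ), z ^ (μ + 1) * p (z * s)) atTop
      (𝓝 (∫ s in Ioi (1 : ℝ), c * s ^ (-1 - μ))) := by
    have heq {z s : ℝ} (hz : 0 < z) (hs : 0 < s) :
        z ^ (μ + 1) * p (z * s) = p (z * s) / (z * s) ^ (-1 - μ) * s ^ (-1 - μ) := by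
      have h1 : z ^ (μ + 1) = (z ^ (-1 - μ))⁻¹ := by
        rw [← Real.rpow_neg hz.le]; ring_nf
      have h2 : s ^ (-1 - μ) ≠ 0 := (Real.rpow_pos_of_pos hs _).ne'
      rw [Real.mul_rpow hz.le hs.le, h1]
      field_simp
    refine tendsto_integral_filter_of_dominated_convergence (fun s => 2 * c * s ^ (-1 - μ)) ?_ ?_
      ((integrableOn_Ioi_rpow_of_lt (by linarith) one_pos).const_mul _) ?_
    · exact Eventually.of_forall fun z => Measurable.aestronglyMeasurable (by fun_prop)
    · obtain ⟨M, hM⟩ := eventually_atTop.1 (h.eventually_lt_const (show c < 2 * c by linarith))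
      filter_upwards [eventually_ge_atTop (max M 1)] with z hz
      have hz1 : 1 ≤ z := (le_max_right _ _).trans hz
      filter_upwards [ae_restrict_mem measurableSet_Ioi] with s hs
      have hs : 1 < s := hs
      have hs0 : 0 < s := by linarith
      rw [Real.norm_of_nonneg (mul_nonneg (by positivity) (hpn _)), heq (by linarith) hs0]
      refine mul_le_mul_of_nonneg_right (hM _ ?_).le (by positivity)
      nlinarith [(le_max_left _ _).trans hz]
    · filter_upwards [ae_restrict_mem measurableSet_Ioi] with s hs
      have hs0 : 0 < s := one_pos.trans hs
      refine ((h.comp (tendsto_id.atTop_mul_const hs0)).mul_const (s ^ (-1 - μ))).congr' ?_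
      filter_upwards [eventually_gt_atTop 0] with z hz
      exact (heq hz hs0).symm
  refine hdct.congr' ?_
  filter_upwards [eventually_gt_atTop 0] with z hz
  have h1 := integral_comp_mul_left_Ioi p 1 hz
  rw [integral_const_mul, h1, mul_one, smul_eq_mul, tail, Real.rpow_add_one hz.ne']
  field_simp

theorem tail_of_endpoint_le {A z : ℝ} (hA : ∀ z, A < z → p z = 0) (hz : A ≤ z) :
    tail p z = 0 :=
  setIntegral_eq_zero_of_forall_eq_zero fun y hy => hA y (hz.trans_lt hy)

/-- The substitution `y = A - w s` reduces the tail to `s ∈ (0,1)`, where `2c s^(μ-1)` dominates and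
is integrable because `μ > 0`. -/
theorem tendsto_rpow_mul_tail_endpoint {A μ c : ℝ} (hpm : Measurable p) (hpn : ∀ z, 0 ≤ p z)
    (hμ : 0 < μ) (hc : 0 < c) (hA : ∀ z, A < z → p z = 0)
    (h : Tendsto (fun z => p z / (A - z) ^ (μ - 1)) (𝓝[<] A) (𝓝 c)) :
    Tendsto (fun w => w ^ (-μ) * tail p (A - w)) (𝓝[>] 0) (𝓝 (c / μ)) := by
  set F : ℝ → ℝ := (Ioo (0 : ℝ) 1).indicator fun s => c * s ^ (μ - 1)
  have hI : IntegrableOn (fun s : ℝ => s ^ (μ - 1)) (Ioo 0 1) :=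
    (intervalIntegrable_iff_integrableOn_Ioo_of_le zero_le_one).1
      (intervalIntegral.intervalIntegrable_rpow' (by linarith))
  have hint : ∫ s, F s = c / μ := by
    rw [integral_indicator measurableSet_Ioo, integral_const_mul, ← integral_Ioc_eq_integral_Ioo,
      ← intervalIntegral.integral_of_le zero_le_one, integral_rpow (Or.inl (by linarith)),
      sub_add_cancel, Real.one_rpow, Real.zero_rpow hμ.ne']
    field_simp
    simp
  rw [← hint]
  have heq {w s : ℝ} (hw : 0 < w) (hs : 0 < s) : w ^ (1 - μ) * p (A - w * s)
      = p (A - w * s) / (A - (A - w * s)) ^ (μ - 1) * s ^ (μ - 1) := by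
    have h1 : w ^ (1 - μ) = (w ^ (μ - 1))⁻¹ := by
      rw [← Real.rpow_neg hw.le]; ring_nf
    have h2 : s ^ (μ - 1) ≠ 0 := (Real.rpow_pos_of_pos hs _).ne'
    rw [sub_sub_cancel, Real.mul_rpow hw.le hs.le, h1]
    field_simp
  -- Negative `s` means `y > A`, where `p` vanishes. The value `s = 0`, that is `y = A`, is excluded
  -- since `p(A)` is arbitrary.
  have hind {w s : ℝ} (hw : 0 < w) (hs0 : s ≠ 0) :
      (Ioi (A - w)).indicator p (A - w * s) = (Ioo 0 1).indicator (fun s => p (A - w * s)) s := by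
    by_cases hs1 : s < 1
    · have : A - w * s ∈ Ioi (A - w) := by
        have : w * s < w * 1 := mul_lt_mul_of_pos_left hs1 hw
        rw [mem_Ioi]
        linarith
      rw [indicator_of_mem this]
      rcases lt_or_gt_of_ne hs0 with hs | hs
      · rw [indicator_of_notMem fun h => hs.not_gt h.1, hA]
        nlinarith
      · rw [indicator_of_mem (show s ∈ Ioo (0 : ℝ) 1 from ⟨hs, hs1⟩)]
    · rw [indicator_of_notMem, indicator_of_notMem fun h => hs1 h.2]
      rw [mem_Ioi, not_lt]
      have : w * 1 ≤ w * s := mul_le_mul_of_nonneg_left (not_lt.1 hs1) hw.le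
      linarith
  have hsub {s : ℝ} (hs : 0 < s) : Tendsto (fun w => A - w * s) (𝓝[>] 0) (𝓝[<] A) := by
    refine tendsto_nhdsWithin_iff.2 ⟨?_, ?_⟩
    · have : Tendsto (fun w : ℝ => A - w * s) (𝓝 0) (𝓝 (A - 0 * s)) :=
        Continuous.tendsto (by fun_prop) 0
      rw [zero_mul, sub_zero] at this
      exact this.mono_left nhdsWithin_le_nhds
    · filter_upwards [self_mem_nhdsWithin] with w hw
      have := mul_pos (mem_Ioi.1 hw) hs
      rw [mem_Iio]
      linarith
  have hne : ({0}ᶜ : Set ℝ) ∈ ae (volume : Measure ℝ) := compl_mem_ae_iff.2 (by simp)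
  have hdct : Tendsto (fun w : ℝ => ∫ s, w ^ (1 - μ) * (Ioi (A - w)).indicator p (A - w * s))
      (𝓝[>] 0) (𝓝 (∫ s, F s)) := by
    refine tendsto_integral_filter_of_dominated_convergence
      ((Ioo (0 : ℝ) 1).indicator fun s => 2 * c * s ^ (μ - 1)) ?_ ?_
      ((integrable_indicator_iff measurableSet_Ioo).2 (hI.const_mul _)) ?_
    · refine Eventually.of_forall fun w => Measurable.aestronglyMeasurable ?_
      exact measurable_const.mul ((hpm.indicator measurableSet_Ioi).comp (by fun_prop))
    · obtain ⟨B, hB, hBs⟩ := (mem_nhdsLT_iff_exists_Ioo_subset).1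
        (h.eventually_lt_const (show c < 2 * c by linarith))
      have hB : B < A := hB
      filter_upwards [self_mem_nhdsWithin,
        mem_nhdsWithin_of_mem_nhds (Iio_mem_nhds (sub_pos.2 hB))] with w hw hwB
      have hw : 0 < w := hw
      have hwB : w < A - B := hwB
      filter_upwards [hne] with s hs
      rw [hind hw hs]
      by_cases hs1 : s ∈ Ioo (0 : ℝ) 1
      · rw [indicator_of_mem hs1, indicator_of_mem hs1,
          Real.norm_of_nonneg (mul_nonneg (by positivity) (hpn _)), heq hw hs1.1]
        have hm : A - w * s ∈ Ioo B A := by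
          have h1 := mul_pos hw hs1.1
          have h2 : w * s < w * 1 := mul_lt_mul_of_pos_left hs1.2 hw
          constructor <;> linarith
        exact mul_le_mul_of_nonneg_right (le_of_lt (hBs hm)) (Real.rpow_nonneg hs1.1.le _)
      · rw [indicator_of_notMem hs1, indicator_of_notMem hs1, mul_zero, norm_zero]
    · filter_upwards [hne] with s hs
      by_cases hs1 : s ∈ Ioo (0 : ℝ) 1
      · have hF : F s = c * s ^ (μ - 1) := indicator_of_mem hs1 _
        rw [hF]
        refine ((h.comp (hsub hs1.1)).mul_const (s ^ (μ - 1))).congr' ?_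
        filter_upwards [self_mem_nhdsWithin] with w hw
        rw [hind hw hs, indicator_of_mem hs1, heq hw hs1.1]
        rfl
      · have hF : F s = 0 := indicator_of_notMem hs1 _
        rw [hF]
        refine tendsto_const_nhds.congr' ?_
        filter_upwards [self_mem_nhdsWithin] with w hw
        rw [hind hw hs, indicator_of_notMem hs1, mul_zero]
  refine hdct.congr' ?_
  filter_upwards [self_mem_nhdsWithin] with w hw
  have hw : 0 < w := hw
  have h1 := Measure.integral_comp_mul_left
    (fun y => (Ioi (A - w)).indicator p (A - y)) w
  rw [integral_const_mul, h1, integral_sub_left_eq_self, integral_indicator measurableSet_Ioi,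
    smul_eq_mul, abs_of_pos (inv_pos.2 hw), ← mul_assoc, ← Real.rpow_neg_one,
    ← Real.rpow_add hw, tail]
  congr 2
  ring

/-! ### Gumbel tails: from `x > 0` to all real `x`. -/

theorem HasGumbelTail.integrableOn (hp : IsPosDensity p) (h : HasGumbelTail p) (t : ℝ) :
    IntegrableOn (tail p) (Ioi t) := by
  obtain ⟨w, hw⟩ := h.integrable
  have h1 : IntegrableOn (tail p) (Icc t w) := hp.continuous_tail.integrableOn_Icc
  refine (h1.union hw).mono_set fun z hz => ?_
  rcases le_or_gt z w with h | h
  · exact Or.inl ⟨le_of_lt hz, h⟩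
  · exact Or.inr h

theorem HasGumbelTail.integral_sub (hp : IsPosDensity p) (h : HasGumbelTail p) (s t : ℝ) :
    (∫ z in Ioi s, tail p z) - ∫ z in Ioi t, tail p z = ∫ z in s..t, tail p z :=
  intervalIntegral.integral_Ioi_sub_Ioi' (h.integrableOn hp s) (h.integrableOn hp t)

theorem HasGumbelTail.integral_pos (hp : IsPosDensity p) (h : HasGumbelTail p) (t : ℝ) :
    0 < ∫ z in Ioi t, tail p z := by
  rw [setIntegral_pos_iff_support_of_nonneg_ae (Eventually.of_forall hp.tail_nonneg)
    (h.integrableOn hp t)]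
  have : Function.support (tail p) = univ := eq_univ_of_forall fun z => (h.tail_pos z).ne'
  simp [this]

theorem HasGumbelTail.meanExcess_pos (hp : IsPosDensity p) (h : HasGumbelTail p) (t : ℝ) :
    0 < meanExcess p t :=
  mul_pos (one_div_pos.2 (h.tail_pos t)) (h.integral_pos hp t)

theorem HasGumbelTail.continuous_meanExcess (hp : IsPosDensity p) (h : HasGumbelTail p) :
    Continuous (meanExcess p) := by
  have h1 : (fun t => ∫ z in Ioi t, tail p z) =
      fun t => (∫ z in Ioi 0, tail p z) - ∫ z in (0 : ℝ)..t, tail p z := by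
    ext t
    rw [← h.integral_sub hp 0 t]
    ring
  have h2 : Continuous fun t => ∫ z in Ioi t, tail p z := by
    rw [h1]
    exact continuous_const.sub (intervalIntegral.continuous_primitive
      (fun _ _ => hp.continuous_tail.intervalIntegrable _ _) 0)
  exact (continuous_const.div hp.continuous_tail fun t => (h.tail_pos t).ne').mul h2

/-- The mean excess is self-neglecting. -/
theorem HasGumbelTail.tendsto_meanExcess_ratio (hp : IsPosDensity p) (h : HasGumbelTail p) {x : ℝ}
    (hx : 0 < x) :
    Tendsto (fun t => meanExcess p (t + x * meanExcess p t) / meanExcess p t) atTop (𝓝 1) := by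
  -- With `G(t) = ∫_t^∞ F̃`, so that `R = G/F̃`, this integral equals `1 - G(t + xR(t))/G(t)`. Hence
  -- the ratios of `G` and of `F̃` both tend to `e^{-x}`, and the ratio of `R` to `1`.
  have hint : Tendsto (fun t => ∫ s in (0 : ℝ)..x, tail p (t + s * meanExcess p t) / tail p t)
      atTop (𝓝 (∫ s in (0 : ℝ)..x, Real.exp (-s))) := by
    refine intervalIntegral.tendsto_integral_filter_of_dominated_convergence (fun _ => 1)
      (Eventually.of_forall fun t => ?_) (Eventually.of_forall fun t => ?_)
      intervalIntegrable_const (Eventually.of_forall fun s hs => ?_)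
    · exact ((hp.continuous_tail.comp (by fun_prop)).div_const _).aestronglyMeasurable
    · refine Eventually.of_forall fun s hs => ?_
      rw [uIoc_of_le hx.le] at hs
      rw [Real.norm_of_nonneg (div_nonneg (hp.tail_nonneg _) (hp.tail_nonneg _)),
        div_le_one (h.tail_pos t)]
      refine hp.tail_antitone ?_
      have := mul_pos hs.1 (h.meanExcess_pos hp t)
      linarith
    · rw [uIoc_of_le hx.le] at hs
      exact h.tendsto s hs.1
  have hexp : ∫ s in (0 : ℝ)..x, Real.exp (-s) = 1 - Real.exp (-x) := by
    rw [intervalIntegral.integral_comp_neg (fun s => Real.exp s), integral_exp]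
    simp
  rw [hexp] at hint
  have h1 := (hint.const_sub 1).div (h.tendsto x hx) (Real.exp_pos _).ne'
  rw [sub_sub_cancel, div_self (Real.exp_pos _).ne'] at h1
  refine h1.congr fun t => ?_
  have hR := h.meanExcess_pos hp t
  have hT := h.tail_pos t
  have hT' := h.tail_pos (t + x * meanExcess p t)
  have hG := h.integral_pos hp t
  have h2 : ∫ s in (0 : ℝ)..x, tail p (t + s * meanExcess p t) / tail p t =
      ((∫ z in Ioi t, tail p z) - ∫ z in Ioi (t + x * meanExcess p t), tail p z) /
        ∫ z in Ioi t, tail p z := by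
    rw [intervalIntegral.integral_div, h.integral_sub hp]
    have h3 := intervalIntegral.integral_comp_add_mul (a := 0) (b := x) (tail p) hR.ne' t
    simp only [mul_comm (meanExcess p t)] at h3
    rw [h3, zero_mul, add_zero, smul_eq_mul]
    have h4 : ∫ z in Ioi t, tail p z = meanExcess p t * tail p t := by
      rw [meanExcess]
      field_simp
    rw [h4]
    field_simp
  rw [Pi.div_apply, h2, one_sub_div hG.ne', sub_sub_cancel]
  generalize hu : t + x * meanExcess p t = u at *
  unfold meanExcess
  field_simp

/-- To look back from `t` with a hypothesis that looks forward, `t` must be written as `s + x R(s)`.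
The intermediate value theorem on `[0,t]` gives `s`; boundedness of `s + x R(s)` on compact sets
forces `s → ∞`. -/
theorem HasGumbelTail.exists_preimage (hp : IsPosDensity p) (h : HasGumbelTail p) {x : ℝ}
    (hx : 0 < x) : ∃ s : ℝ → ℝ, Tendsto s atTop atTop ∧
      ∀ᶠ t in atTop, s t + x * meanExcess p (s t) = t := by
  have hc : Continuous fun s => s + x * meanExcess p s :=
    continuous_id.add (continuous_const.mul (h.continuous_meanExcess hp))
  have hex : ∀ t, ∃ s, 0 + x * meanExcess p 0 ≤ t → 0 ≤ s ∧ s + x * meanExcess p s = t := by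
    intro t
    by_cases ht : 0 + x * meanExcess p 0 ≤ t
    · have h0 := mul_pos hx (h.meanExcess_pos hp 0)
      have h1 := mul_pos hx (h.meanExcess_pos hp t)
      obtain ⟨s, hs, hst⟩ := intermediate_value_Icc (show (0 : ℝ) ≤ t by linarith)
        hc.continuousOn ⟨ht, by linarith⟩
      exact ⟨s, fun _ => ⟨hs.1, hst⟩⟩
    · exact ⟨0, fun h => absurd h ht⟩
  choose s hs using hex
  refine ⟨s, tendsto_atTop.2 fun M => ?_, ?_⟩
  · obtain ⟨K, hK⟩ := (isCompact_Icc (a := (0 : ℝ)) (b := M)).bddAbove_image hc.continuousOn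
    filter_upwards [eventually_gt_atTop K, eventually_ge_atTop (0 + x * meanExcess p 0)]
      with t htK ht
    obtain ⟨h0, h1⟩ := hs t ht
    by_contra hM
    have := hK ⟨s t, ⟨h0, (not_le.1 hM).le⟩, h1⟩
    linarith
  · filter_upwards [eventually_ge_atTop (0 + x * meanExcess p 0)] with t ht using (hs t ht).2

/-- For `t = s + x R(s)`, the forward limit at `s` inverts to `F̃(s)/F̃(t) → e^x`. In units of
`R(t)` the backward step is `ρ = x R(s)/R(t)`, which tends to `x` since `R` is self-neglecting. -/
theorem HasGumbelTail.exists_backward (hp : IsPosDensity p) (h : HasGumbelTail p) {x : ℝ}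
    (hx : 0 < x) : ∃ ρ : ℝ → ℝ, Tendsto ρ atTop (𝓝 x) ∧
      Tendsto (fun t => tail p (t - ρ t * meanExcess p t) / tail p t) atTop
        (𝓝 (Real.exp x)) := by
  obtain ⟨s, hs, hst⟩ := h.exists_preimage hp hx
  refine ⟨fun t => x * (meanExcess p (s t) / meanExcess p t), ?_, ?_⟩
  · have h1 := (((h.tendsto_meanExcess_ratio hp hx).comp hs).inv₀ one_ne_zero).const_mul x
    rw [inv_one, mul_one] at h1
    refine h1.congr' ?_
    filter_upwards [hst] with t ht
    simp only [Function.comp_apply]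
    rw [ht, inv_div]
  · have h1 := ((h.tendsto x hx).comp hs).inv₀ (Real.exp_pos _).ne'
    rw [← Real.exp_neg, neg_neg] at h1
    refine h1.congr' ?_
    filter_upwards [hst] with t ht
    have hR := (h.meanExcess_pos hp t).ne'
    have h2 : t - x * (meanExcess p (s t) / meanExcess p t) * meanExcess p t = s t := by
      field_simp
      linarith
    simp only [Function.comp_apply]
    rw [h2, ht, inv_div]

/-- The step `ρ` is only asymptotically right. Monotonicity of `F̃` lets steps tending to some `y <
x` or `y > x` bound the exact one from below or above, and continuity of `exp` closes the gap. -/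
theorem HasGumbelTail.tendsto_neg (hp : IsPosDensity p) (h : HasGumbelTail p) {x : ℝ}
    (hx : 0 < x) :
    Tendsto (fun t => tail p (t - x * meanExcess p t) / tail p t) atTop (𝓝 (Real.exp x)) := by
  have hcont : ContinuousAt Real.exp x := Real.continuous_exp.continuousAt
  refine tendsto_order.2 ⟨fun b hb => ?_, fun b hb => ?_⟩
  · obtain ⟨y, hy, hy0, hyx⟩ := (((hcont.eventually_const_lt hb).filter_mono
      nhdsWithin_le_nhds).and (eventually_mem_set.2 (Ioo_mem_nhdsLT hx))).exists
    obtain ⟨ρ, hρ, hlim⟩ := h.exists_backward hp hy0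
    filter_upwards [hρ.eventually_lt_const hyx, hlim.eventually_const_lt hy] with t h1 h2
    refine h2.trans_le (div_le_div_of_nonneg_right (hp.tail_antitone ?_) (hp.tail_nonneg t))
    have := mul_le_mul_of_nonneg_right h1.le (h.meanExcess_pos hp t).le
    linarith
  · obtain ⟨y, hy, hyx⟩ := (((hcont.eventually_lt_const hb).filter_mono
      nhdsWithin_le_nhds).and (self_mem_nhdsWithin (s := Ioi x))).exists
    have hyx : x < y := hyx
    obtain ⟨ρ, hρ, hlim⟩ := h.exists_backward hp (hx.trans hyx)
    filter_upwards [hρ.eventually_const_lt hyx, hlim.eventually_lt_const hy] with t h1 h2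
    refine lt_of_le_of_lt (div_le_div_of_nonneg_right (hp.tail_antitone ?_) (hp.tail_nonneg t)) h2
    have := mul_le_mul_of_nonneg_right h1.le (h.meanExcess_pos hp t).le
    linarith

theorem HasGumbelTail.tendsto_of_real (hp : IsPosDensity p) (h : HasGumbelTail p) (x : ℝ) :
    Tendsto (fun t => tail p (t + x * meanExcess p t) / tail p t) atTop (𝓝 (Real.exp (-x))) := by
  rcases lt_trichotomy x 0 with hx | rfl | hx
  · have := h.tendsto_neg hp (neg_pos.2 hx)
    simpa only [neg_mul, sub_neg_eq_add] using this
  · simp [div_self (h.tail_pos _).ne']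
  · exact h.tendsto x hx

/-- Continuity of `F̃` gives exact `1/N` quantiles; they tend to infinity because `F̃` never
vanishes. -/
theorem HasGumbelTail.exists_quantile (hp : IsPosDensity p) (h : HasGumbelTail p) :
    ∃ b : ℕ → ℝ, Tendsto b atTop atTop ∧ ∀ N : ℕ, 1 ≤ N → N * tail p (b N) = 1 := by
  have hex : ∀ N : ℕ, ∃ b, 1 ≤ N → N * tail p b = 1 := by
    intro N
    by_cases hN : 1 ≤ N
    · have hN' : (0 : ℝ) < N := by exact_mod_cast hN
      obtain ⟨B, hB⟩ := (hp.tendsto_tail_atTop.eventually_lt_const (one_div_pos.2 hN')).exists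
      obtain ⟨b, hb⟩ := mem_range_of_exists_le_of_exists_ge hp.continuous_tail ⟨B, hB.le⟩
        ⟨0, by
          rw [hp.tail_of_nonpos le_rfl, div_le_one hN']
          exact_mod_cast hN⟩
      refine ⟨b, fun _ => ?_⟩
      rw [hb]
      field_simp
    · exact ⟨0, fun h => absurd h hN⟩
  choose b hb using hex
  refine ⟨b, tendsto_atTop.2 fun M => ?_, hb⟩
  have hlim := (tendsto_natCast_atTop_atTop (R := ℝ)).atTop_mul_const (h.tail_pos M)
  filter_upwards [hlim.eventually_gt_atTop 1, eventually_ge_atTop 1] with N h1 hN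
  by_contra hM
  have h2 := hp.tail_antitone (not_le.1 hM).le
  have h3 := hb N hN
  have h4 := mul_le_mul_of_nonneg_left h2 (Nat.cast_nonneg (α := ℝ) N)
  linarith

end GEV

/-! ### Choice of the rescaling in the three cases. -/

theorem mainTheorem2
    (p : ℝ → ℝ) (hp : GEV.IsPosDensity p)
    (a : ℝ) (ha : 0 < a)
    (Ω : ℝ → ℝ) (hΩm : Measurable Ω) (hΩpos : ∀ t ∈ Ioo (0 : ℝ) 1, 0 < Ω t)
    (hΩ : ∃ c : ℝ, 0 < c ∧ Tendsto (fun t => Ω t / t ^ (a - 1)) (𝓝[>] 0) (𝓝 c))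
    (N₀ : ℕ) (hN₀ : 1 ≤ N₀)
    (hZ : IntegrableOn (fun t => Ω t * (1 - t) ^ (N₀ - 1)) (Ioo (0 : ℝ) 1)) :
    (∀ N, N₀ ≤ N → IsProbabilityMeasure (GEV.jointLaw p Ω N)) ∧
    (GEV.HasGumbelTail p →
      GEV.RescaledSumTendsto (GEV.jointLaw p Ω) (GEV.gumbelPDF a)) ∧
    (∀ μ : ℝ, 0 < μ → GEV.HasPowerTail p μ →
      GEV.RescaledSumTendsto (GEV.jointLaw p Ω) (GEV.frechetPDF a μ)) ∧
    (∀ A μ : ℝ, 0 < μ → GEV.HasPowerEndpoint p A μ →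
      GEV.RescaledSumTendsto (GEV.jointLaw p Ω) (GEV.weibullPDF a μ)) := by
  obtain ⟨c, hc, hΩ⟩ := hΩ
  refine ⟨fun N hN => ?_, fun h => ?_, fun μ hμ h => ?_, fun A μ hμ h => ?_⟩
  · exact hp.jointLaw_isProbabilityMeasure hΩm hΩpos (hN₀.trans hN)
      (GEV.integrableOn_weight hΩm hN hZ)
  · obtain ⟨b, hb, hbN⟩ := h.exists_quantile hp
    have hθ := GEV.gumbelTheta_pos ha
    -- With `y = θ(x + ν) - ln a` the target level is `a e^{-θ(x+ν)} = e^{-y}`, and `α`, `β` are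
    -- chosen so that `α_N + β_N x = b_N + y R(b_N)`.
    refine hp.rescaledSumTendsto ha hc hΩm hΩpos hΩ hN₀ hZ (GEV.lawOf_gumbelPDF_univ ha)
      (α := fun N => b N + GEV.meanExcess p (b N) *
        (GEV.gumbelTheta a * GEV.gumbelNu a - Real.log a))
      (β := fun N => GEV.meanExcess p (b N) * GEV.gumbelTheta a)
      (fun N => mul_pos (h.meanExcess_pos hp _) hθ) fun x => Or.inl ?_
    refine ⟨_, by positivity, ?_, GEV.lawOf_gumbelPDF_Iic ha x⟩
    set y := GEV.gumbelTheta a * (x + GEV.gumbelNu a) - Real.log a with hy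
    have hexp : a * Real.exp (-GEV.gumbelTheta a * (x + GEV.gumbelNu a)) = Real.exp (-y) := by
      rw [hy, neg_sub, sub_eq_add_neg, Real.exp_add, Real.exp_log ha, neg_mul]
    rw [hexp]
    refine ((h.tendsto_of_real hp y).comp hb).congr' ?_
    filter_upwards [eventually_ge_atTop 1] with N hN
    have hT := h.tail_pos (b N)
    have h1 := hbN N hN
    have h2 : (N : ℝ) = 1 / GEV.tail p (b N) := by
      field_simp
      exact h1
    have h3 : b N + GEV.meanExcess p (b N) * (GEV.gumbelTheta a * GEV.gumbelNu a - Real.log a) +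
        GEV.meanExcess p (b N) * GEV.gumbelTheta a * x = b N + y * GEV.meanExcess p (b N) := by
      rw [hy]
      ring
    rw [h3, Function.comp_apply, h2]
    ring
  · obtain ⟨c', hc', h⟩ := h
    have hT := GEV.tendsto_rpow_mul_tail hp.measurable hp.nonneg hμ hc' h
    have hl := GEV.frechetScale_pos ha hμ
    set l := GEV.frechetScale a μ with hldef
    -- As `F̃(z) ∼ (c'/μ) z^{-μ}`, this solves `N (c'/μ) β^{-μ} = l`. The maximum with `1` only
    -- keeps `β 0` positive.
    set β : ℕ → ℝ := fun N => (c' * max (N : ℝ) 1 / (μ * l)) ^ (1 / μ) with hβdef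
    have hβ (N : ℕ) : 0 < β N := by positivity
    have hβμ (N : ℕ) : β N ^ μ = c' * max (N : ℝ) 1 / (μ * l) := by
      rw [hβdef, ← Real.rpow_mul (by positivity), one_div_mul_cancel hμ.ne', Real.rpow_one]
    refine hp.rescaledSumTendsto ha hc hΩm hΩpos hΩ hN₀ hZ (GEV.lawOf_frechetPDF_univ ha hμ)
      (α := fun _ => 0) hβ fun x => ?_
    simp only [zero_add]
    rcases le_or_gt x 0 with hx | hx
    · exact Or.inr ⟨fun N => hp.tail_of_nonpos (mul_nonpos_of_nonneg_of_nonpos (hβ N).le hx),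
        GEV.lawOf_frechetPDF_Iic_of_nonpos ha hμ hx⟩
    · refine Or.inl ⟨_, by positivity, ?_, GEV.lawOf_frechetPDF_Iic ha hμ hx⟩
      have hβt : Tendsto β atTop atTop := by
        refine (tendsto_rpow_atTop (one_div_pos.2 hμ)).comp ?_
        refine Tendsto.atTop_div_const (by positivity) (Tendsto.const_mul_atTop hc' ?_)
        exact tendsto_atTop_mono (fun N => le_max_left _ _) tendsto_natCast_atTop_atTop
      have hlim := (hT.comp (hβt.atTop_mul_const hx)).mul_const (μ * l / c' * x ^ (-μ))
      have hval : c' / μ * (μ * l / c' * x ^ (-μ)) = l * x ^ (-μ) := by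
        field_simp
      rw [hval] at hlim
      refine hlim.congr' ?_
      filter_upwards [eventually_ge_atTop 1] with N hN
      have hN' : (1 : ℝ) ≤ N := by exact_mod_cast hN
      have hxμ : x ^ μ ≠ 0 := (Real.rpow_pos_of_pos hx _).ne'
      rw [Function.comp_apply, Real.mul_rpow (hβ N).le hx.le, hβμ, max_eq_left hN',
        Real.rpow_neg hx.le]
      field_simp
  · obtain ⟨hA, c', hc', h⟩ := h
    have hT := GEV.tendsto_rpow_mul_tail_endpoint hp.measurable hp.nonneg hμ hc' hA h
    have hl := GEV.weibullScale_pos ha hμ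
    set l := GEV.weibullScale a μ with hldef
    -- As `F̃(A - w) ∼ (c'/μ) w^μ`, this solves `N (c'/μ) β^μ = l` for `N ≥ 1`.
    set β : ℕ → ℝ := fun N => (μ * l / c' * (max (N : ℝ) 1)⁻¹) ^ (1 / μ) with hβdef
    have hβ (N : ℕ) : 0 < β N := by positivity
    have hβμ (N : ℕ) : β N ^ μ = μ * l / c' * (max (N : ℝ) 1)⁻¹ := by
      rw [hβdef, ← Real.rpow_mul (by positivity), one_div_mul_cancel hμ.ne', Real.rpow_one]
    refine hp.rescaledSumTendsto ha hc hΩm hΩpos hΩ hN₀ hZ (GEV.lawOf_weibullPDF_univ ha hμ)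
      (α := fun _ => A) hβ fun x => Or.inl ?_
    rcases le_or_gt 0 x with hx | hx
    · refine ⟨0, le_rfl, ?_, GEV.lawOf_weibullPDF_Iic_of_nonneg ha hμ hx⟩
      refine tendsto_const_nhds.congr fun N => ?_
      have := mul_nonneg (hβ N).le hx
      rw [GEV.tail_of_endpoint_le hA (by linarith), mul_zero]
    · have hx0 : 0 < -x := by linarith
      refine ⟨_, by positivity, ?_, GEV.lawOf_weibullPDF_Iic ha hμ hx⟩
      have hβt : Tendsto β atTop (𝓝 0) := by
        have h1 : Tendsto (fun N : ℕ => μ * l / c' * (max (N : ℝ) 1)⁻¹) atTop (𝓝 0) := by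
          have h2 : Tendsto (fun N : ℕ => max (N : ℝ) 1) atTop atTop :=
            tendsto_atTop_mono (fun N => le_max_left _ _) tendsto_natCast_atTop_atTop
          simpa using h2.inv_tendsto_atTop.const_mul (μ * l / c')
        have h2 := h1.rpow_const (p := 1 / μ) (Or.inr (by positivity))
        rwa [Real.zero_rpow (by positivity)] at h2
      have hβx : Tendsto (fun N => β N * -x) atTop (𝓝[>] 0) := by
        refine tendsto_nhdsWithin_iff.2 ⟨by simpa using hβt.mul_const (-x), ?_⟩
        exact Eventually.of_forall fun N => mul_pos (hβ N) hx0
      have hlim := (hT.comp hβx).mul_const (μ * l / c' * (-x) ^ μ)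
      have hval : c' / μ * (μ * l / c' * (-x) ^ μ) = l * (-x) ^ μ := by
        field_simp
      rw [hval] at hlim
      refine hlim.congr' ?_
      filter_upwards [eventually_ge_atTop 1] with N hN
      have hN' : (1 : ℝ) ≤ N := by exact_mod_cast hN
      have hN0 : (N : ℝ) ≠ 0 := by positivity
      have hxμ : (-x) ^ μ ≠ 0 := (Real.rpow_pos_of_pos hx0 _).ne'
      have hz : A - β N * -x = A + β N * x := by ring
      rw [Function.comp_apply, Real.rpow_neg (mul_pos (hβ N) hx0).le,
        Real.mul_rpow (hβ N).le hx0.le, hβμ, max_eq_left hN', hz]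
      field_simp
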